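/- Let $G\subset \mathrm{GL}(n,\mathbb R)$ be a real linear algebraic group (a subgroup cut out of $\mathrm{GL}(n,\mathbb R)$ by polynomial equations), and let $M\subset\mathbb R^n$ be a smooth real affine algebraic variety (the real zero set of a family of polynomials, nonsingular in the sense of the Jacobian criterion) such that the linear action of $G$ on $\mathbb R^n$ maps $M$ into itself. Let $\mathrm C_0(M)$ be the Banach space of continuous complex-valued functions on $M$ vanishing at infinity, with the supremum norm, and let $\pi$ be the left regular representation of $G$ on it, $(\pi(g)\phi)(m)=\phi(g^{-1}m)$. Let $\mathfrak g=\{X\in M_n(\mathbb R): e^{hX}\in G \text{ for all } h\in\mathbb R\}$ be the Lie algebra of $G$. For $X\in\mathfrak g$ let $d\pi(X)$ be the generator of $h\mapsto\pi(e^{hX})$, i.e. $d\pi(X)\phi=\frac{d}{dh}\pi(e^{hX})\phi\big|_{h=0}$ (norm derivative), with domain $\mathcal D(d\pi(X))$ the set of all $\phi\in \mathrm C_0(M)$ for which this derivative exists. Let $\mathcal P=\mathbb C[M]\cdot e^{-r^2}\subset \mathrm C_0(M)$, where $\mathbb C[M]$ is the ring of restrictions to $M$ of complex polynomials on $\mathbb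 R^n$ and $r^2(m)=m_1^2+\dots+m_n^2$. For $X_1,\dots,X_k\in\mathfrak g$ let $$\Gamma_{X_1,\dots,X_k}=\Big\{(\phi,d\pi(X_1)\phi,\dots,d\pi(X_k)\phi):\ \phi\in\bigcap_{i=1}^k\mathcal D(d\pi(X_i))\Big\}\subset \mathrm C_0(M)^{k+1}$$ be the joint graph, and let $\Gamma_{X_1,\dots,X_k|\mathcal P}=\Gamma_{X_1,\dots,X_k}\cap(\mathcal P\times\dots\times\mathcal P)$ be its restriction to $\mathcal P\times\dots\times\mathcal P$. **Theorem.** For all $X_1,\dots,X_k\in\mathfrak g$, $$\Gamma_{X_1,\dots,X_k}=\overline{\Gamma_{X_1,\dots,X_k|\mathcal P}},$$ the closure being taken in the product of the norm topologies on $\mathrm C_0(M)^{k+1}$. In particular, $\Gamma_{a_1,\dots,a_d}=\overline{\Gamma_{a_1,\dots,a_d|\mathcal P}}$ for every basis $a_1,\dots,a_d$ of $\mathfrak g$. Thus the generators are completely determined by their action on $\mathcal P$: for every $X\in\mathfrak g$ one has $\mathcal P\subset\mathcal D(d\pi(X))$, and $d\pi(X)$ is the closure of its restriction to $\mathcal P$.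 -/

import Mathlib

open scoped ZeroAtInfty

noncomputable section

namespace RealGVariety

/-- A real linear algebraic group: a subgroup of `GL(n, ℝ)` that is cut out of `GL(n, ℝ)` by
polynomial equations in the matrix entries. -/
def IsRealLinearAlgebraicGroup {n : ℕ} (G : Subgroup (GL (Fin n) ℝ)) : Prop :=
  ∃ S : Set (MvPolynomial (Fin n × Fin n) ℝ), ∀ g : GL (Fin n) ℝ,
    g ∈ G ↔ ∀ p ∈ S,
      MvPolynomial.eval (fun ij : Fin n × Fin n => (g : Matrix (Fin n) (Fin n) ℝ) ij.1 ij.2) p = 0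

/-- `M ⊆ ℝⁿ` is the common zero set of a family of real polynomials. -/
def IsRealAffineVariety {n : ℕ} (M : Set (Fin n → ℝ)) : Prop :=
  ∃ S : Set (MvPolynomial (Fin n) ℝ), M = {x | ∀ p ∈ S, MvPolynomial.eval x p = 0}

/-- Smoothness (Jacobian criterion): near each of its points `m`, the set `M` is the zero set of
finitely many polynomials that vanish on `M` and whose gradients at `m` are linearly independent.
The number of these polynomials, i.e. the codimension, may vary with `m`. -/
def IsSmooth {n : ℕ} (M : Set (Fin n → ℝ)) : Prop :=
  ∀ m ∈ M, ∃ (c : ℕ) (f : Fin c → MvPolynomial (Fin n) ℝ),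
    (∀ i, ∀ x ∈ M, MvPolynomial.eval x (f i) = 0) ∧
    LinearIndependent ℝ
      (fun (i : Fin c) (j : Fin n) => MvPolynomial.eval m (MvPolynomial.pderiv j (f i))) ∧
    ∃ U ∈ nhds m, ∀ x ∈ U, (∀ i, MvPolynomial.eval x (f i) = 0) → x ∈ M

/-- The matrix group `G` maps `M` into itself. -/
def Preserves {n : ℕ} (G : Subgroup (GL (Fin n) ℝ)) (M : Set (Fin n → ℝ)) : Prop :=
  ∀ g ∈ G, ∀ m ∈ M, (g : Matrix (Fin n) (Fin n) ℝ).mulVec m ∈ M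

/-- The homeomorphism `m ↦ g m` of `M`, for `g ∈ G`. -/
def actHomeo {n : ℕ} {G : Subgroup (GL (Fin n) ℝ)} {M : Set (Fin n → ℝ)} (hGM : Preserves G M)
    (g : G) : M ≃ₜ M where
  toFun m := ⟨((g : GL (Fin n) ℝ) : Matrix (Fin n) (Fin n) ℝ).mulVec m, hGM g g.2 m m.2⟩
  invFun m := ⟨(((g⁻¹ : G) : GL (Fin n) ℝ) : Matrix (Fin n) (Fin n) ℝ).mulVec m,
    hGM (g⁻¹ : G) (g⁻¹ : G).2 m m.2⟩
  left_inv m := by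
    apply Subtype.ext
    simp only [Matrix.mulVec_mulVec, ← Units.val_mul, ← Subgroup.coe_mul]
    simp
  right_inv m := by
    apply Subtype.ext
    simp only [Matrix.mulVec_mulVec, ← Units.val_mul, ← Subgroup.coe_mul]
    simp
  continuous_toFun := by
    refine Continuous.subtype_mk ?_ _
    exact Continuous.matrix_mulVec continuous_const continuous_subtype_val
  continuous_invFun := by
    refine Continuous.subtype_mk ?_ _
    exact Continuous.matrix_mulVec continuous_const continuous_subtype_val

/-- The left regular representation of `G` on the Banach space `C₀(M, ℂ)` (sup norm) by bounded
linear operators: `(π(g) φ)(m) = φ(g⁻¹ m)`. -/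
def leftRegular {n : ℕ} {G : Subgroup (GL (Fin n) ℝ)} {M : Set (Fin n → ℝ)}
    (hGM : Preserves G M) : G →* (C₀(M, ℂ) →L[ℂ] C₀(M, ℂ)) where
  toFun g := LinearMap.mkContinuous
    (ZeroAtInftyContinuousMap.compLinearMap (R := ℂ) (actHomeo hGM g⁻¹).toCocompactMap) 1
    (by
      intro φ
      rw [one_mul, ← ZeroAtInftyContinuousMap.norm_toBCF_eq_norm,
        BoundedContinuousFunction.norm_le (norm_nonneg _)]
      intro m
      rw [← ZeroAtInftyContinuousMap.norm_toBCF_eq_norm]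
      exact φ.toBCF.norm_coe_le_norm _)
  map_one' := by
    ext φ m
    change φ _ = φ m
    congr 1
    apply Subtype.ext
    change (((1⁻¹ : G) : GL (Fin n) ℝ) : Matrix (Fin n) (Fin n) ℝ).mulVec m = m
    simp
  map_mul' g h := by
    ext φ m
    change φ _ = φ _
    congr 1
    apply Subtype.ext
    change ((((g * h)⁻¹ : G) : GL (Fin n) ℝ) : Matrix (Fin n) (Fin n) ℝ).mulVec m =
      (((h⁻¹ : G) : GL (Fin n) ℝ) : Matrix (Fin n) (Fin n) ℝ).mulVec
        ((((g⁻¹ : G) : GL (Fin n) ℝ) : Matrix (Fin n) (Fin n) ℝ).mulVec m)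
    rw [Matrix.mulVec_mulVec, ← Units.val_mul, ← Subgroup.coe_mul, mul_inv_rev]

theorem leftRegular_apply {n : ℕ} {G : Subgroup (GL (Fin n) ℝ)} {M : Set (Fin n → ℝ)}
    (hGM : Preserves G M) (g : G) (φ : C₀(M, ℂ)) (m : M) :
    leftRegular hGM g φ m = φ (actHomeo hGM g⁻¹ m) := rfl

/-- The matrix exponential, as an element of `GL(n, ℝ)`. -/
def expGL {n : ℕ} (X : Matrix (Fin n) (Fin n) ℝ) : GL (Fin n) ℝ :=
  (Matrix.isUnit_exp X).unit

/-- (The underlying set of) the Lie algebra of `G`: the matrices `X` whose one-parameter group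
`h ↦ e^{hX}` lies in `G`. -/
def lieAlg {n : ℕ} (G : Subgroup (GL (Fin n) ℝ)) : Set (Matrix (Fin n) (Fin n) ℝ) :=
  {X | ∀ h : ℝ, expGL (h • X) ∈ G}

/-- `e^{hX}` as an element of `G`, for `X` in the Lie algebra. -/
def expG {n : ℕ} {G : Subgroup (GL (Fin n) ℝ)} (X : lieAlg G) (h : ℝ) : G :=
  ⟨expGL (h • (X : Matrix (Fin n) (Fin n) ℝ)), X.2 h⟩

/-- The generator `dπ(X)`, an unbounded operator in `C₀(M)`. Its domain consists of those `φ` for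
which the norm derivative of `h ↦ π(e^{hX}) φ` at `h = 0` exists, and `dπ(X) φ` is this
derivative. -/
def generator {n : ℕ} {G : Subgroup (GL (Fin n) ℝ)} {M : Set (Fin n → ℝ)} (hGM : Preserves G M)
    (X : lieAlg G) : C₀(M, ℂ) →ₗ.[ℂ] C₀(M, ℂ) where
  domain :=
    { carrier := {φ | DifferentiableAt ℝ (fun h : ℝ => leftRegular hGM (expG X h) φ) 0}
      add_mem' := by
        intro φ ψ hφ hψ
        simp only [Set.mem_ofPred_eq, map_add] at *
        exact hφ.add hψ
      zero_mem' := by simp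
      smul_mem' := by
        intro c φ hφ
        simp only [Set.mem_ofPred_eq, map_smul] at *
        exact hφ.const_smul c }
  toFun :=
    { toFun := fun φ => deriv (fun h : ℝ => leftRegular hGM (expG X h) (φ : C₀(M, ℂ))) 0
      map_add' := by
        rintro ⟨φ, hφ⟩ ⟨ψ, hψ⟩
        simp only [Submodule.coe_add, map_add]
        exact deriv_fun_add hφ hψ
      map_smul' := by
        rintro c ⟨φ, hφ⟩
        simp only [Submodule.coe_smul, map_smul, RingHom.id_apply]
        exact deriv_fun_const_smul c hφ }

/-- The subspace `𝒫 = ℂ[M] · e^{-r²}` of `C₀(M)`: restrictions to `M` of complex polynomials on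
`ℝⁿ`, multiplied by `e^{-r²}`, where `r² = m₁² + ⋯ + mₙ²`. -/
def gaussPoly {n : ℕ} (M : Set (Fin n → ℝ)) : Submodule ℂ C₀(M, ℂ) where
  carrier := {φ | ∃ p : MvPolynomial (Fin n) ℂ, ∀ m : M,
    φ m = MvPolynomial.eval (fun i => ((m : Fin n → ℝ) i : ℂ)) p *
      (Real.exp (-∑ i, (m : Fin n → ℝ) i ^ 2) : ℂ)}
  add_mem' := by
    rintro φ ψ ⟨p, hp⟩ ⟨q, hq⟩
    refine ⟨p + q, fun m => ?_⟩
    rw [ZeroAtInftyContinuousMap.add_apply, hp, hq, map_add, add_mul]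
  zero_mem' := ⟨0, fun m => by simp⟩
  smul_mem' := by
    rintro c φ ⟨p, hp⟩
    refine ⟨MvPolynomial.C c * p, fun m => ?_⟩
    rw [ZeroAtInftyContinuousMap.smul_apply, hp, map_mul, MvPolynomial.eval_C, smul_eq_mul,
      mul_assoc]

/-- The joint graph `{(φ, A₁ φ, …, A_k φ) : φ ∈ ⋂ᵢ D(Aᵢ)}` of unbounded operators
`A₁, …, A_k`. -/
def jointGraph {E : Type*} [AddCommGroup E] [Module ℂ E] {k : ℕ} (A : Fin k → (E →ₗ.[ℂ] E)) :
    Set (E × (Fin k → E)) :=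
  {z | ∃ h : ∀ i, z.1 ∈ (A i).domain, ∀ i, z.2 i = A i ⟨z.1, h i⟩}

/-- The restriction of the joint graph to `P × ⋯ × P`. -/
def jointGraphRestrict {E : Type*} [AddCommGroup E] [Module ℂ E] {k : ℕ}
    (A : Fin k → (E →ₗ.[ℂ] E)) (P : Submodule ℂ E) : Set (E × (Fin k → E)) :=
  {z ∈ jointGraph A | z.1 ∈ P ∧ ∀ i, z.2 i ∈ P}

end RealGVariety

end

/-!
Write `E = C₀(M)` and `𝒫 = ℂ[M] e^{-r²}`. The argument is an analytic one, on the closed subset `M`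
of `ℝⁿ`; smoothing takes place along the group, never in charts of `M`.

Every element of `𝒫` is smooth along the action, and a linear vector field maps `𝒫` into itself. So
the restricted joint graph is the set `polyGraph` of all `(φ, X₁ φ, …, X_k φ)` with `φ ∈ 𝒫`, and it
is contained in the joint graph, which is closed. It remains to approximate an arbitrary element of
the joint graph by elements of `polyGraph`. Four facts are used.

* `𝒫` is dense in `E` (`dense_gaussPoly`). This is the Stone–Weierstrass theorem on the one-point
  compactification of `M`, applied to the algebra of multipliers of the closure of `𝒫`; that algebra
  contains the functions `p e^{-r²/4}` since `e^{-r²/4}` has a power series expansion that converges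
  well enough against `e^{-r²}` (`tendsto_gp_mul_expSum`).
* For `g ∈ G` near `1` and `φ ∈ 𝒫`, the translate `π(g) φ` and its derivatives are limits of
  elements of `polyGraph` (`leftRegular_gp_mem`), by the same power series for `e^{r² - r² ∘ g⁻¹}`.
* The closure of `polyGraph` for a single `X` is the whole graph of `dπ(X)`
  (`IsGen.mem_closure_polyGraph`): average over the one-parameter group `e^{hX}`.
* Near `1` there are enough directions in `G`: if `a₁, …, a_d` in the Lie algebra form a basis of
  its span `W`, then `W` is stable under the adjoint action of `G`, and the derivatives of
  `F(t) = e^{t₁ a₁} ⋯ e^{t_d a_d}` at a small `t` exhaust `W F(t)` (`exists_coordinates`).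

The last step is a version of Friedrichs' commutator lemma along the group. Put
`S_ε φ = ∫ ρ(u) π(F(ε u)) φ du` with a bump function `ρ` of integral `1`. For `φ ∈ 𝒫`, integration
by parts in `u` rewrites both `X S_ε φ` and `S_ε X φ` as averages of translates of `φ`
(`wavg_kernel_gp`), with kernels that do not involve derivatives of `φ`. By density the first
formula shows that `(S_ε φ, X₁ S_ε φ, …, X_k S_ε φ)` is in the closure of `polyGraph` for every
`φ ∈ E` (`wavg_mem_polyGraph`), and by the third fact the second formula holds for all `φ` in
the domain of `dπ(X)` (`IsGen.wavg_eq`). The difference of the two kernels has integral `0` and stays bounded as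
`ε → 0` because the two underlying vector fields agree at `0` (`exists_abs_kernel_le`). Hence
`X_i S_ε φ - S_ε X_i φ → 0`, and `S_ε φ`, `X_i S_ε φ` converge to `φ`, `X_i φ`
(`mem_closure_polyGraph_of_isGen`).
-/

open scoped ZeroAtInfty ContDiff
open Filter Topology MeasureTheory

noncomputable section

namespace RealGVariety

attribute [local instance] Matrix.linftyOpNormedAddCommGroup Matrix.linftyOpNormedSpace
  Matrix.linftyOpNormedRing Matrix.linftyOpNormedAlgebra

variable {n d : ℕ} {M : Set (Fin n → ℝ)} {G : Subgroup (GL (Fin n) ℝ)} {ι : Type*}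

/-! ### Polynomials times a Gaussian on `ℝⁿ` -/

/-- `r² = x₁² + ⋯ + xₙ²`. -/
def rsq {n : ℕ} (x : Fin n → ℝ) : ℝ := ∑ i, x i ^ 2

/-- The value of a complex polynomial at a real point. -/
def evalR {n : ℕ} (x : Fin n → ℝ) : MvPolynomial (Fin n) ℂ →+* ℂ :=
  MvPolynomial.eval (fun i => (x i : ℂ))

/-- The function `p e^{-r²}` on `ℝⁿ`. -/
def gaussFun {n : ℕ} (p : MvPolynomial (Fin n) ℂ) (x : Fin n → ℝ) : ℂ :=
  evalR x p * (Real.exp (-rsq x) : ℂ)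

@[simp] theorem evalR_C (x : Fin n → ℝ) (c : ℂ) : evalR x (MvPolynomial.C c) = c := by
  simp [evalR]

@[simp] theorem evalR_X (x : Fin n → ℝ) (i : Fin n) : evalR x (MvPolynomial.X i) = x i := by
  simp [evalR]

theorem rsq_nonneg (x : Fin n → ℝ) : 0 ≤ rsq x := Finset.sum_nonneg fun _ _ => sq_nonneg _

theorem sq_apply_le_rsq (x : Fin n → ℝ) (i : Fin n) : x i ^ 2 ≤ rsq x :=
  Finset.single_le_sum (f := fun i => x i ^ 2) (fun _ _ => sq_nonneg _) (Finset.mem_univ i)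

theorem sq_norm_le_rsq (x : Fin n → ℝ) : ‖x‖ ^ 2 ≤ rsq x := by
  have h : ‖x‖ ≤ √(rsq x) := by
    refine (pi_norm_le_iff_of_nonneg (Real.sqrt_nonneg _)).2 fun i => ?_
    rw [Real.norm_eq_abs]
    exact Real.abs_le_sqrt (sq_apply_le_rsq x i)
  calc ‖x‖ ^ 2 ≤ √(rsq x) ^ 2 := by gcongr
    _ = rsq x := Real.sq_sqrt (rsq_nonneg x)

theorem continuous_rsq : Continuous (rsq : (Fin n → ℝ) → ℝ) := by
  unfold rsq; fun_prop

theorem continuous_evalR (p : MvPolynomial (Fin n) ℂ) : Continuous fun x => evalR x p := by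
  have := MvPolynomial.continuous_eval p
  exact this.comp (by fun_prop : Continuous fun (x : Fin n → ℝ) (i : Fin n) => (x i : ℂ))

theorem continuous_gaussFun (p : MvPolynomial (Fin n) ℂ) : Continuous (gaussFun p) := by
  unfold gaussFun
  have := continuous_evalR p
  have := continuous_rsq (n := n)
  fun_prop

/-- A polynomial is dominated by every Gaussian growth rate `e^{δ r²}`, `δ > 0`. -/
theorem exists_norm_evalR_le (p : MvPolynomial (Fin n) ℂ) :
    ∀ δ : ℝ, 0 < δ → ∃ C, 0 ≤ C ∧ ∀ x, ‖evalR x p‖ ≤ C * Real.exp (δ * rsq x) := by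
  induction p using MvPolynomial.induction_on with
  | C a =>
    intro δ hδ
    refine ⟨‖a‖, norm_nonneg _, fun x => ?_⟩
    rw [evalR_C]
    exact le_mul_of_one_le_right (norm_nonneg _)
      (Real.one_le_exp (mul_nonneg hδ.le (rsq_nonneg x)))
  | add p q hp hq =>
    intro δ hδ
    obtain ⟨C, hC, h⟩ := hp δ hδ
    obtain ⟨C', hC', h'⟩ := hq δ hδ
    refine ⟨C + C', add_nonneg hC hC', fun x => ?_⟩
    rw [map_add, add_mul]
    exact (norm_add_le _ _).trans (add_le_add (h x) (h' x))
  | mul_X p i hp =>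
    intro δ hδ
    obtain ⟨C, hC, h⟩ := hp (δ / 2) (half_pos hδ)
    refine ⟨C * (1 + 2 / δ), by positivity, fun x => ?_⟩
    have h1 : |x i| ≤ (1 + 2 / δ) * Real.exp (δ / 2 * rsq x) := by
      have h2 : |x i| ≤ 1 + rsq x := by
        have := sq_apply_le_rsq x i
        rw [← sq_abs] at this
        nlinarith [sq_nonneg (|x i| - 1)]
      have h3 : δ / 2 * rsq x ≤ Real.exp (δ / 2 * rsq x) :=
        (by linarith : _ ≤ δ / 2 * rsq x + 1).trans (Real.add_one_le_exp _)
      have h4 : 1 ≤ Real.exp (δ / 2 * rsq x) :=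
        Real.one_le_exp (mul_nonneg (half_pos hδ).le (rsq_nonneg x))
      have h5 : rsq x = 2 / δ * (δ / 2 * rsq x) := by field_simp
      calc |x i| ≤ 1 + rsq x := h2
        _ = 1 + 2 / δ * (δ / 2 * rsq x) := by rw [← h5]
        _ ≤ Real.exp (δ / 2 * rsq x) + 2 / δ * Real.exp (δ / 2 * rsq x) := by gcongr
        _ = _ := by ring
    have h6 : Real.exp (δ * rsq x) = Real.exp (δ / 2 * rsq x) * Real.exp (δ / 2 * rsq x) := by
      rw [← Real.exp_add]; ring_nf
    rw [map_mul, norm_mul, evalR_X, Complex.norm_real, Real.norm_eq_abs, h6]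
    calc _ ≤ (C * Real.exp (δ / 2 * rsq x)) * ((1 + 2 / δ) * Real.exp (δ / 2 * rsq x)) := by
          gcongr; exact h x
      _ = _ := by ring

theorem tendsto_exp_neg_rsq {δ : ℝ} (hδ : 0 < δ) :
    Tendsto (fun x : Fin n → ℝ => Real.exp (-(δ * rsq x))) (cocompact (Fin n → ℝ)) (𝓝 0) := by
  refine Real.tendsto_exp_neg_atTop_nhds_zero.comp (Tendsto.const_mul_atTop hδ ?_)
  refine tendsto_atTop_mono sq_norm_le_rsq ?_
  exact (tendsto_pow_atTop two_ne_zero).comp (tendsto_norm_cocompact_atTop (E := Fin n → ℝ))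

theorem tendsto_gaussFun (p : MvPolynomial (Fin n) ℂ) :
    Tendsto (gaussFun p) (cocompact (Fin n → ℝ)) (𝓝 0) := by
  obtain ⟨C, hC, h⟩ := exists_norm_evalR_le p (1 / 2) (by norm_num)
  have := (tendsto_exp_neg_rsq (n := n) (δ := 1 / 2) (by norm_num)).const_mul C
  rw [mul_zero] at this
  refine squeeze_zero_norm (fun x => ?_) this
  rw [gaussFun, norm_mul, Complex.norm_real, Real.norm_eq_abs, Real.abs_exp]
  calc _ ≤ C * Real.exp (1 / 2 * rsq x) * Real.exp (-rsq x) := by gcongr; exact h x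
    _ = _ := by rw [mul_assoc, ← Real.exp_add]; ring_nf

/-- The restriction of `p e^{-r²}` to a closed set `M`, as an element of `C₀(M)`. -/
def gp (hM : IsClosed M) (p : MvPolynomial (Fin n) ℂ) : C₀(M, ℂ) where
  toFun m := gaussFun p m
  continuous_toFun := (continuous_gaussFun p).comp continuous_subtype_val
  zero_at_infty' := (tendsto_gaussFun p).comp hM.isClosedEmbedding_subtypeVal.tendsto_cocompact

@[simp] theorem gp_apply (hM : IsClosed M) (p : MvPolynomial (Fin n) ℂ) (m : M) :
    gp hM p m = gaussFun p m := rfl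

theorem mem_gaussPoly_iff (hM : IsClosed M) {φ : C₀(M, ℂ)} :
    φ ∈ gaussPoly M ↔ ∃ p, φ = gp hM p := by
  constructor
  · rintro ⟨p, hp⟩
    exact ⟨p, ZeroAtInftyContinuousMap.ext hp⟩
  · rintro ⟨p, rfl⟩
    exact ⟨p, fun m => rfl⟩

/-- `p ↦ p e^{-r²}` as a linear map. -/
def gpLin (hM : IsClosed M) : MvPolynomial (Fin n) ℂ →ₗ[ℂ] C₀(M, ℂ) where
  toFun := gp hM
  map_add' p q := by ext m; simp [gaussFun, add_mul]
  map_smul' c p := by ext m; simp [gaussFun, MvPolynomial.smul_eq_C_mul, mul_assoc]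

theorem norm_le_of_forall {φ : C₀(M, ℂ)} {C : ℝ} (hC : 0 ≤ C) (h : ∀ m, ‖φ m‖ ≤ C) : ‖φ‖ ≤ C := by
  rw [← ZeroAtInftyContinuousMap.norm_toBCF_eq_norm]
  exact (BoundedContinuousFunction.norm_le hC).2 h

theorem norm_apply_le (φ : C₀(M, ℂ)) (m : M) : ‖φ m‖ ≤ ‖φ‖ := by
  rw [← ZeroAtInftyContinuousMap.norm_toBCF_eq_norm]
  exact φ.toBCF.norm_coe_le_norm m

/-- The `N`-th Taylor polynomial of `e^B`. -/
def expSum (B : MvPolynomial (Fin n) ℂ) (N : ℕ) : MvPolynomial (Fin n) ℂ :=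
  ∑ l ∈ Finset.range N, MvPolynomial.C ((l.factorial : ℂ)⁻¹) * B ^ l

/-- If `|b| ≤ r² / 4`, then `e^{b - r²}` is approximated by the functions
`(∑_{l < N} b^l / l!) e^{-r²}`, uniformly even after multiplication by a polynomial: the `l`-th
term of the series is at most `2^{-l} (r² / 2)^l / l!`, so the remainder is at most
`2^{-N} e^{r² / 2}`. -/
theorem tendsto_gp_mul_expSum (hM : IsClosed M) (p B : MvPolynomial (Fin n) ℂ)
    (b : (Fin n → ℝ) → ℝ) (hB : ∀ x, evalR x B = b x) (hb : ∀ x, |b x| ≤ rsq x / 4)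
    (ψ : C₀(M, ℂ)) (hψ : ∀ m : M, ψ m = evalR (m : Fin n → ℝ) p *
      (Real.exp (b m - rsq (m : Fin n → ℝ)) : ℂ)) :
    Tendsto (fun N => gp hM (p * expSum B N)) atTop (𝓝 ψ) := by
  obtain ⟨C, hC, h⟩ := exists_norm_evalR_le p (1 / 2) (by norm_num)
  have key : ∀ (N : ℕ) (y r : ℝ), |y| ≤ r / 4 →
      |Real.exp y - ∑ l ∈ Finset.range N, y ^ l / l.factorial| ≤
        (1 / 2) ^ N * Real.exp (r / 2) := by
    intro N y r hy
    have hs : HasSum (fun l : ℕ => y ^ l / l.factorial) (Real.exp y) := by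
      rw [Real.exp_eq_exp_ℝ]; exact NormedSpace.expSeries_div_hasSum_exp y
    have hs' : HasSum (fun l : ℕ => (r / 2) ^ l / l.factorial) (Real.exp (r / 2)) := by
      rw [Real.exp_eq_exp_ℝ]; exact NormedSpace.expSeries_div_hasSum_exp (r / 2)
    have h1 := (hasSum_nat_add_iff' N).2 hs
    rw [← Real.norm_eq_abs, ← h1.tsum_eq]
    have hr : 0 ≤ r := by have := abs_nonneg y; linarith
    have h2 := ((hasSum_nat_add_iff' N).2 hs').mul_left ((1 / 2 : ℝ) ^ N)
    refine (tsum_of_norm_bounded h2 fun l => ?_).trans ?_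
    · rw [norm_div, norm_pow, Real.norm_eq_abs, Real.norm_natCast, ← mul_div_assoc]
      gcongr
      calc |y| ^ (l + N) ≤ (r / 4) ^ (l + N) := by gcongr
        _ = (1 / 2) ^ N * ((1 / 2) ^ l * (r / 2) ^ (l + N)) := by
          rw [show r / 4 = 1 / 2 * (r / 2) by ring, mul_pow, pow_add (1 / 2 : ℝ)]; ring
        _ ≤ (1 / 2) ^ N * (1 * (r / 2) ^ (l + N)) := by
          gcongr; exact pow_le_one₀ (by norm_num) (by norm_num)
        _ = _ := by rw [one_mul]
    · gcongr
      exact sub_le_self _ (Finset.sum_nonneg fun _ _ => by positivity)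
  refine tendsto_iff_norm_sub_tendsto_zero.2 ?_
  have hlim : Tendsto (fun N : ℕ => C * (1 / 2 : ℝ) ^ N) atTop (𝓝 0) := by
    simpa using (tendsto_pow_atTop_nhds_zero_of_lt_one (r := (1 / 2 : ℝ)) (by norm_num)
      (by norm_num)).const_mul C
  refine squeeze_zero (fun _ => norm_nonneg _) (fun N => ?_) hlim
  refine norm_le_of_forall (by positivity) fun m => ?_
  have hev : evalR (m : Fin n → ℝ) (expSum B N) =
      ((∑ l ∈ Finset.range N, b m ^ l / l.factorial : ℝ) : ℂ) := by
    simp [expSum, map_sum, hB, div_eq_inv_mul]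
  have h3 : (gp hM (p * expSum B N) - ψ) m = evalR m p *
      ((-(Real.exp (b m) - ∑ l ∈ Finset.range N, b m ^ l / l.factorial) *
        Real.exp (-rsq (m : Fin n → ℝ)) : ℝ) : ℂ) := by
    rw [ZeroAtInftyContinuousMap.sub_apply, hψ, gp_apply, gaussFun, map_mul, hev,
      sub_eq_add_neg (b m), Real.exp_add]
    push_cast
    ring
  rw [h3, norm_mul, Complex.norm_real, norm_mul, norm_neg, Real.norm_eq_abs, Real.norm_eq_abs,
    Real.abs_exp]
  calc _ ≤ (C * Real.exp (1 / 2 * rsq (m : Fin n → ℝ))) *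
        (((1 / 2) ^ N * Real.exp (rsq (m : Fin n → ℝ) / 2)) *
          Real.exp (-rsq (m : Fin n → ℝ))) := by
        gcongr
        · exact h m
        · exact key N _ _ (hb m)
    _ = C * (1 / 2) ^ N * (Real.exp (1 / 2 * rsq (m : Fin n → ℝ)) *
          Real.exp (rsq (m : Fin n → ℝ) / 2) * Real.exp (-rsq (m : Fin n → ℝ))) := by ring
    _ = C * (1 / 2) ^ N := by
      rw [← Real.exp_add, ← Real.exp_add]
      ring_nf
      simp

/-! ### Density of the polynomial-Gaussian functions in `C₀(M)` -/

/-- Multiplication of a function in `C₀(M)` by a continuous function on the one-point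
compactification. -/
def mulOnePoint (g : C(OnePoint M, ℂ)) (φ : C₀(M, ℂ)) : C₀(M, ℂ) where
  toFun m := g m * φ m
  continuous_toFun := (g.continuous.comp OnePoint.continuous_coe).mul φ.continuous
  zero_at_infty' := by
    have h := (φ.zero_at_infty').norm.const_mul ‖g‖
    rw [norm_zero, mul_zero] at h
    refine squeeze_zero_norm (fun m => ?_) h
    rw [norm_mul]
    exact mul_le_mul_of_nonneg_right (g.norm_coe_le_norm _) (norm_nonneg _)

@[simp] theorem mulOnePoint_apply (g : C(OnePoint M, ℂ)) (φ : C₀(M, ℂ)) (m : M) :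
    mulOnePoint g φ m = g m * φ m := rfl

theorem norm_mulOnePoint_le (g : C(OnePoint M, ℂ)) (φ : C₀(M, ℂ)) :
    ‖mulOnePoint g φ‖ ≤ ‖g‖ * ‖φ‖ := by
  refine norm_le_of_forall (by positivity) fun m => ?_
  rw [mulOnePoint_apply, norm_mul]
  exact mul_le_mul (g.norm_coe_le_norm _) (norm_apply_le φ m) (norm_nonneg _) (norm_nonneg _)

/-- The extension by zero at infinity of a function in `C₀(M)`. -/
def extendOnePoint [LocallyCompactSpace M] (φ : C₀(M, ℂ)) : C(OnePoint M, ℂ) where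
  toFun x := x.elim 0 φ
  continuous_toFun := by
    rw [continuous_iff_continuousAt]
    intro x
    induction x using OnePoint.rec with
    | infty =>
      rw [OnePoint.continuousAt_infty']
      simpa [Filter.coclosedCompact_eq_cocompact, Function.comp_def] using φ.zero_at_infty'
    | coe m =>
      rw [OnePoint.continuousAt_coe]
      exact φ.continuous.continuousAt

@[simp] theorem extendOnePoint_coe [LocallyCompactSpace M] (φ : C₀(M, ℂ)) (m : M) :
    extendOnePoint φ m = φ m := rfl

@[simp] theorem extendOnePoint_infty [LocallyCompactSpace M] (φ : C₀(M, ℂ)) :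
    extendOnePoint φ OnePoint.infty = 0 := rfl

/-- The continuous functions on the one-point compactification of `M` that multiply, together with
their conjugates, the closed subspace `A` into itself. -/
def multiplierAlgebra (A : Submodule ℂ C₀(M, ℂ)) : StarSubalgebra ℂ C(OnePoint M, ℂ) where
  carrier := {g | (∀ φ ∈ A, mulOnePoint g φ ∈ A) ∧ ∀ φ ∈ A, mulOnePoint (star g) φ ∈ A}
  mul_mem' := by
    rintro f g ⟨hf, hf'⟩ ⟨hg, hg'⟩
    refine ⟨fun φ hφ => ?_, fun φ hφ => ?_⟩
    · convert hf _ (hg φ hφ) using 1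
      ext m; simp [mul_assoc]
    · convert hf' _ (hg' φ hφ) using 1
      ext m; simp [mul_left_comm, mul_comm]
  add_mem' := by
    rintro f g ⟨hf, hf'⟩ ⟨hg, hg'⟩
    refine ⟨fun φ hφ => ?_, fun φ hφ => ?_⟩
    · convert A.add_mem (hf _ hφ) (hg φ hφ) using 1
      ext m; simp [add_mul]
    · convert A.add_mem (hf' _ hφ) (hg' φ hφ) using 1
      ext m; simp [add_mul]
  algebraMap_mem' := by
    intro c
    refine ⟨fun φ hφ => ?_, fun φ hφ => ?_⟩
    · convert A.smul_mem c hφ using 1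
      ext m; simp
    · convert A.smul_mem (star c) hφ using 1
      ext m; simp
  star_mem' := by
    rintro f ⟨hf, hf'⟩
    exact ⟨hf', by simpa using hf⟩

theorem isClosed_multiplierAlgebra {A : Submodule ℂ C₀(M, ℂ)} (hA : IsClosed (A : Set C₀(M, ℂ))) :
    IsClosed (multiplierAlgebra A : Set C(OnePoint M, ℂ)) := by
  have hc : ∀ φ : C₀(M, ℂ), Continuous fun g : C(OnePoint M, ℂ) => mulOnePoint g φ := by
    intro φ
    refine (LipschitzWith.of_dist_le_mul (K := ‖φ‖₊) fun f g => ?_).continuous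
    rw [dist_eq_norm, dist_eq_norm, mul_comm]
    have : mulOnePoint f φ - mulOnePoint g φ = mulOnePoint (f - g) φ := by
      ext m; simp [sub_mul]
    rw [this]
    exact norm_mulOnePoint_le _ _
  have h : (multiplierAlgebra A : Set C(OnePoint M, ℂ)) =
      (⋂ φ ∈ A, {g | mulOnePoint g φ ∈ A}) ∩ ⋂ φ ∈ A, {g | mulOnePoint (star g) φ ∈ A} := by
    ext g
    simp only [Set.mem_inter_iff, Set.mem_iInter]
    rfl
  rw [h]
  refine (isClosed_biInter fun φ _ => hA.preimage (hc φ)).inter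
    (isClosed_biInter fun φ _ => hA.preimage ((hc φ).comp continuous_star))

theorem exists_evalR_eq_star (p : MvPolynomial (Fin n) ℂ) :
    ∃ q : MvPolynomial (Fin n) ℂ, ∀ x, evalR x q = star (evalR x p) := by
  induction p using MvPolynomial.induction_on with
  | C a => exact ⟨MvPolynomial.C (star a), fun x => by simp⟩
  | add p q hp hq =>
    obtain ⟨p', hp⟩ := hp
    obtain ⟨q', hq⟩ := hq
    exact ⟨p' + q', fun x => by rw [map_add, map_add, hp, hq, star_add]⟩
  | mul_X p i hp =>
    obtain ⟨p', hp⟩ := hp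
    exact ⟨p' * MvPolynomial.X i, fun x => by simp [hp]⟩

/-- The functions `p e^{-r²/4}` on `M`. -/
def gpQuarter (hM : IsClosed M) (p : MvPolynomial (Fin n) ℂ) : C₀(M, ℂ) where
  toFun m := evalR (m : Fin n → ℝ) p * (Real.exp (-(rsq (m : Fin n → ℝ) / 4)) : ℂ)
  continuous_toFun := by
    have h1 := (continuous_evalR p).comp (continuous_subtype_val (p := (· ∈ M)))
    have h2 := (continuous_rsq (n := n)).comp (continuous_subtype_val (p := (· ∈ M)))
    simp only [Function.comp_def] at h1 h2
    fun_prop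
  zero_at_infty' := by
    obtain ⟨C, hC, h⟩ := exists_norm_evalR_le p (1 / 8) (by norm_num)
    have := ((tendsto_exp_neg_rsq (n := n) (δ := 1 / 8) (by norm_num)).const_mul C).comp
      hM.isClosedEmbedding_subtypeVal.tendsto_cocompact
    rw [mul_zero] at this
    refine squeeze_zero_norm (fun x => ?_) this
    rw [norm_mul, Complex.norm_real, Real.norm_eq_abs, Real.abs_exp]
    calc _ ≤ C * Real.exp (1 / 8 * rsq (x : Fin n → ℝ)) *
          Real.exp (-(rsq (x : Fin n → ℝ) / 4)) := by gcongr; exact h x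
      _ = _ := by
        rw [mul_assoc, ← Real.exp_add, Function.comp_apply]
        ring_nf

theorem gpQuarter_apply (hM : IsClosed M) (p : MvPolynomial (Fin n) ℂ) (m : M) :
    gpQuarter hM p m =
      evalR (m : Fin n → ℝ) p * (Real.exp (-(rsq (m : Fin n → ℝ) / 4)) : ℂ) := rfl

/-- Multiplication by `q e^{-r²/4}` maps the closure of the span of the `p e^{-r²}` into itself,
because `e^{-r²/4}` may be expanded into a power series. -/
theorem mulOnePoint_gpQuarter_mem [LocallyCompactSpace M] (hM : IsClosed M)
    (q : MvPolynomial (Fin n) ℂ) :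
    ∀ φ ∈ (gaussPoly M).topologicalClosure,
      mulOnePoint (extendOnePoint (gpQuarter hM q)) φ ∈ (gaussPoly M).topologicalClosure := by
  set g := extendOnePoint (gpQuarter hM q) with hg
  have hc : Continuous (mulOnePoint g) := by
    refine (LipschitzWith.of_dist_le_mul (K := ‖g‖₊) fun φ ψ => ?_).continuous
    rw [dist_eq_norm, dist_eq_norm]
    have : mulOnePoint g φ - mulOnePoint g ψ = mulOnePoint g (φ - ψ) := by
      ext m; simp [mul_sub]
    rw [this]
    exact norm_mulOnePoint_le _ _
  have key : Set.MapsTo (mulOnePoint g) (gaussPoly M) (closure (gaussPoly M : Set C₀(M, ℂ))) := by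
    intro φ hφ
    obtain ⟨p, rfl⟩ := (mem_gaussPoly_iff hM).1 hφ
    refine mem_closure_of_tendsto (tendsto_gp_mul_expSum hM (q * p)
      (-∑ i, MvPolynomial.C ((4 : ℂ)⁻¹) * MvPolynomial.X i ^ 2) (fun x => -(rsq x / 4)) ?_ ?_ _ ?_)
      (Eventually.of_forall fun N => (mem_gaussPoly_iff hM).2 ⟨_, rfl⟩)
    · intro x
      simp [rsq, map_sum, div_eq_inv_mul, Finset.mul_sum]
    · intro x
      rw [abs_neg, abs_of_nonneg (div_nonneg (rsq_nonneg x) (by norm_num))]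
    · intro m
      rw [mulOnePoint_apply, hg, extendOnePoint_coe, gpQuarter_apply, gp_apply, gaussFun, map_mul,
        sub_eq_add_neg, Real.exp_add]
      push_cast
      ring
  intro φ hφ
  have := key.closure hc hφ
  rwa [closure_closure] at this

/-- The space `ℂ[M] e^{-r²}` is dense in `C₀(M)`. By Stone–Weierstrass on the one-point
compactification, its closure is stable under multiplication by all continuous functions there, and
so it contains every compactly supported `φ = (φ e^{r²}) e^{-r²}`; these are dense. -/
theorem dense_gaussPoly (hM : IsClosed M) : Dense (gaussPoly M : Set C₀(M, ℂ)) := by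
  have : LocallyCompactSpace M := hM.isClosedEmbedding_subtypeVal.locallyCompactSpace
  set A := (gaussPoly M).topologicalClosure with hAdef
  have hA : IsClosed (A : Set C₀(M, ℂ)) := (gaussPoly M).isClosed_topologicalClosure
  have hmem : ∀ q, extendOnePoint (gpQuarter hM q) ∈ multiplierAlgebra A := by
    intro q
    refine ⟨mulOnePoint_gpQuarter_mem hM q, ?_⟩
    obtain ⟨q', hq'⟩ := exists_evalR_eq_star q
    convert mulOnePoint_gpQuarter_mem hM q' using 4 with φ hφ
    ext x
    induction x using OnePoint.rec with
    | infty => simp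
    | coe m =>
      simp only [ContinuousMap.star_apply, extendOnePoint_coe, gpQuarter_apply, hq', star_mul',
        RCLike.star_def, Complex.conj_ofReal]
  have hsep : (multiplierAlgebra A).SeparatesPoints := by
    have hne : ∀ m : M, gpQuarter hM 1 m ≠ 0 := fun m => by
      simp [gpQuarter_apply]
    have h1 : ∀ m : M, ∃ f ∈ (fun f : C(OnePoint M, ℂ) => (f : OnePoint M → ℂ)) ''
        ((multiplierAlgebra A).toSubalgebra : Set C(OnePoint M, ℂ)),
        f m ≠ f OnePoint.infty := fun m =>
      ⟨_, ⟨_, hmem 1, rfl⟩, by simpa using hne m⟩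
    intro x y hxy
    induction x using OnePoint.rec with
    | infty =>
      induction y using OnePoint.rec with
      | infty => exact absurd rfl hxy
      | coe m =>
        obtain ⟨f, hf, h⟩ := h1 m
        exact ⟨f, hf, h.symm⟩
    | coe m =>
      induction y using OnePoint.rec with
      | infty => exact h1 m
      | coe m' =>
        by_contra hcon
        push Not at hcon
        have h2 : ∀ q, gpQuarter hM q m = gpQuarter hM q m' := fun q =>
          hcon _ ⟨_, hmem q, rfl⟩
        apply hxy
        congr 1
        apply Subtype.ext
        ext i
        have h3 := h2 (MvPolynomial.X i)
        have h4 := h2 1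
        have h5 := hne m'
        simp only [gpQuarter_apply, map_one, one_mul, evalR_X] at h3 h4 h5
        rw [h4] at h3
        exact_mod_cast mul_right_cancel₀ h5 h3
  have htop := ContinuousMap.starSubalgebra_topologicalClosure_eq_top_of_separatesPoints _ hsep
  have hall : ∀ g : C(OnePoint M, ℂ), g ∈ multiplierAlgebra A := by
    intro g
    have hg : g ∈ (multiplierAlgebra A).topologicalClosure := htop ▸ trivial
    rw [← SetLike.mem_coe, StarSubalgebra.topologicalClosure_coe,
      (isClosed_multiplierAlgebra hA).closure_eq] at hg
    exact hg
  set w : C₀(M, ℂ) := gp hM 1 with hw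
  have hwA : w ∈ A := subset_closure ((mem_gaussPoly_iff hM).2 ⟨1, rfl⟩)
  have hwm : ∀ m : M, w m = (Real.exp (-rsq (m : Fin n → ℝ)) : ℂ) := fun m => by
    simp [hw, gaussFun]
  have hwn : ∀ m : M, ‖w m‖ = Real.exp (-rsq (m : Fin n → ℝ)) := fun m => by
    rw [hwm, Complex.norm_real, Real.norm_eq_abs, Real.abs_exp]
  intro φ
  change φ ∈ (A : Set C₀(M, ℂ))
  rw [← hA.closure_eq, Metric.mem_closure_iff]
  intro ε hε
  have h0 : ∀ᶠ m in cocompact M, ‖φ m‖ < ε / 2 := by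
    simpa using (Metric.tendsto_nhds.1 φ.zero_at_infty') (ε / 2) (half_pos hε)
  obtain ⟨K, hK, hKφ⟩ := mem_cocompact.1 h0
  obtain ⟨R, hR⟩ := (hK.image (continuous_rsq.comp continuous_subtype_val)).bddAbove
  -- the approximate unit `N w / (1 + N w)`, with `w = e^{-r²}`, is close to `1` where `r² ≤ R`
  obtain ⟨N, hN⟩ := exists_nat_gt (‖φ‖ * Real.exp R / (ε / 2))
  have hN0 : (0 : ℝ) < N := lt_of_le_of_lt (by positivity) hN
  have hpos : ∀ y : ℂ, 0 < 1 + N * ‖y‖ := fun y => by positivity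
  let u : C(OnePoint M, ℂ) := ⟨fun x => ((N / (1 + N * ‖extendOnePoint w x‖) : ℝ) : ℂ), by
    refine Complex.continuous_ofReal.comp (Continuous.div (by fun_prop) (by fun_prop) ?_)
    exact fun x => (hpos _).ne'⟩
  refine ⟨_, (hall (extendOnePoint φ * u)).1 w hwA, ?_⟩
  rw [dist_eq_norm]
  refine lt_of_le_of_lt (norm_le_of_forall (half_pos hε).le fun m => ?_) (half_lt_self hε)
  have h1 : (φ - mulOnePoint (extendOnePoint φ * u) w) m =
      φ m * ((1 / (1 + N * ‖w m‖) : ℝ) : ℂ) := by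
    have hu : u m = ((N / (1 + N * ‖w m‖) : ℝ) : ℂ) := rfl
    have h2 : ((w m : ℂ)) = (‖w m‖ : ℂ) := by rw [hwn, hwm]
    have h3 := (hpos (w m)).ne'
    generalize ‖w m‖ = r at hu h2 h3 ⊢
    rw [ZeroAtInftyContinuousMap.sub_apply, mulOnePoint_apply, ContinuousMap.mul_apply,
      extendOnePoint_coe, hu, h2, mul_assoc, ← Complex.ofReal_mul]
    nth_rw 1 [← mul_one (φ m)]
    rw [← mul_sub, ← Complex.ofReal_one, ← Complex.ofReal_sub]
    congr 2
    field_simp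
    ring
  rw [h1, norm_mul, Complex.norm_real, Real.norm_of_nonneg (by have := hpos (w m); positivity)]
  by_cases hm : m ∈ K
  · have hRm : rsq (m : Fin n → ℝ) ≤ R := hR ⟨m, hm, rfl⟩
    have h4 : N * Real.exp (-R) ≤ 1 + N * ‖w m‖ := by
      rw [hwn]
      have : Real.exp (-R) ≤ Real.exp (-rsq (m : Fin n → ℝ)) :=
        Real.exp_le_exp.2 (neg_le_neg hRm)
      nlinarith
    calc ‖φ m‖ * (1 / (1 + N * ‖w m‖)) ≤ ‖φ‖ * (1 / (N * Real.exp (-R))) := by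
          gcongr
          exact norm_apply_le φ m
      _ = ‖φ‖ * Real.exp R / N := by rw [Real.exp_neg]; field_simp
      _ ≤ ε / 2 := by
        rw [div_le_iff₀ hN0]
        rw [div_lt_iff₀ (half_pos hε)] at hN
        linarith
  · have h5 : ‖φ m‖ < ε / 2 := hKφ hm
    have h6 : 1 / (1 + N * ‖w m‖) ≤ 1 := by
      rw [div_le_one (hpos _)]
      have : 0 ≤ N * ‖w m‖ := by positivity
      linarith
    calc _ ≤ ‖φ m‖ * 1 := by gcongr
      _ ≤ ε / 2 := by rw [mul_one]; exact h5.le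

/-! ### Linear vector fields acting on polynomials times a Gaussian -/

/-- The polynomial `r²`. -/
def rsqPoly (n : ℕ) : MvPolynomial (Fin n) ℂ := ∑ i, MvPolynomial.X i ^ 2

theorem evalR_rsqPoly (x : Fin n → ℝ) : evalR x (rsqPoly n) = rsq x := by
  simp [rsqPoly, rsq]

/-- The linear vector field `x ↦ -Z x` as a derivation of the polynomial ring. -/
def linDer (Z : Matrix (Fin n) (Fin n) ℝ) :
    Derivation ℂ (MvPolynomial (Fin n) ℂ) (MvPolynomial (Fin n) ℂ) :=
  MvPolynomial.mkDerivation ℂ fun i => -∑ j, MvPolynomial.C (Z i j : ℂ) * MvPolynomial.X j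

/-- The polynomial `q` for which `q e^{-r²}` is the derivative of `p e^{-r²}` along the vector field
`x ↦ -Z x`. -/
def gaussDer (Z : Matrix (Fin n) (Fin n) ℝ) (p : MvPolynomial (Fin n) ℂ) :
    MvPolynomial (Fin n) ℂ :=
  linDer Z p - p * linDer Z (rsqPoly n)

theorem contDiff_evalR (p : MvPolynomial (Fin n) ℂ) : ContDiff ℝ ∞ fun x => evalR x p := by
  induction p using MvPolynomial.induction_on with
  | C a => simpa using contDiff_const
  | add p q hp hq => simpa using hp.add hq
  | mul_X p i hp =>
    simp only [map_mul, evalR_X]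
    exact hp.mul (Complex.ofRealCLM.contDiff.comp (contDiff_apply ℝ ℝ i))

theorem gaussFun_eq (p : MvPolynomial (Fin n) ℂ) :
    gaussFun p = fun x => evalR x p * Complex.exp (-evalR x (rsqPoly n)) := by
  ext x
  rw [gaussFun, evalR_rsqPoly]
  push_cast
  rfl

theorem contDiff_gaussFun (p : MvPolynomial (Fin n) ℂ) : ContDiff ℝ ∞ (gaussFun p) := by
  rw [gaussFun_eq]
  exact (contDiff_evalR p).mul (contDiff_evalR _).neg.cexp

theorem fderiv_evalR (Z : Matrix (Fin n) (Fin n) ℝ) (p : MvPolynomial (Fin n) ℂ)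
    (x : Fin n → ℝ) : fderiv ℝ (fun x => evalR x p) x (-Z.mulVec x) = evalR x (linDer Z p) := by
  have hd : ∀ q : MvPolynomial (Fin n) ℂ, DifferentiableAt ℝ (fun x => evalR x q) x :=
    fun q => (contDiff_evalR q).differentiable (by simp) x
  induction p using MvPolynomial.induction_on with
  | C a => simp
  | add p q hp hq =>
    simp only [map_add]
    rw [fderiv_fun_add (hd p) (hd q), add_apply, hp, hq]
  | mul_X p i hp =>
    have hX : fderiv ℝ (fun x : Fin n → ℝ => ((x i : ℝ) : ℂ)) x (-Z.mulVec x) =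
        evalR x (linDer Z (MvPolynomial.X i)) := by
      have h1 : HasFDerivAt (fun x : Fin n → ℝ => ((x i : ℝ) : ℂ))
          (Complex.ofRealCLM.comp (ContinuousLinearMap.proj i)) x :=
        (Complex.ofRealCLM.comp
          (ContinuousLinearMap.proj (R := ℝ) (φ := fun _ : Fin n => ℝ) i)).hasFDerivAt
      rw [h1.fderiv]
      simp [linDer, Matrix.mulVec, dotProduct, MvPolynomial.mkDerivation_X]
    have hdX := hd (MvPolynomial.X i)
    simp only [map_mul, evalR_X, Derivation.leibniz, map_add, smul_eq_mul] at hdX ⊢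
    rw [fderiv_fun_mul (hd p) hdX, add_apply, smul_apply,
      smul_apply, hX, hp]
    simp

theorem fderiv_gaussFun (Z : Matrix (Fin n) (Fin n) ℝ) (p : MvPolynomial (Fin n) ℂ)
    (x : Fin n → ℝ) : fderiv ℝ (gaussFun p) x (-Z.mulVec x) = gaussFun (gaussDer Z p) x := by
  have hd : ∀ q : MvPolynomial (Fin n) ℂ, DifferentiableAt ℝ (fun x => evalR x q) x :=
    fun q => (contDiff_evalR q).differentiable (by simp) x
  rw [gaussFun_eq, gaussFun_eq, fderiv_fun_mul (hd p) (hd _).fun_neg.cexp,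
    add_apply, smul_apply, smul_apply,
    (hd _).fun_neg.hasFDerivAt.cexp.fderiv, fderiv_fun_neg, smul_apply,
    neg_apply, fderiv_evalR, fderiv_evalR, gaussDer]
  simp only [smul_eq_mul, map_sub, map_mul]
  ring

/-- `Z ↦ (gaussDer Z p) e^{-r²}` is linear. -/
def gpDer (hM : IsClosed M) (p : MvPolynomial (Fin n) ℂ) :
    Matrix (Fin n) (Fin n) ℝ →ₗ[ℝ] C₀(M, ℂ) where
  toFun Z := gp hM (gaussDer Z p)
  map_add' Z Z' := by
    ext m
    rw [ZeroAtInftyContinuousMap.add_apply, gp_apply, gp_apply, gp_apply, ← fderiv_gaussFun,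
      ← fderiv_gaussFun, ← fderiv_gaussFun, ← map_add, Matrix.add_mulVec, neg_add]
  map_smul' c Z := by
    ext m
    rw [ZeroAtInftyContinuousMap.smul_apply, gp_apply, gp_apply, ← fderiv_gaussFun,
      ← fderiv_gaussFun, RingHom.id_apply, ← map_smul, Matrix.smul_mulVec, smul_neg]

/-! ### The one-parameter groups `π(e^{hX})` and their generators -/

/-- The matrix of an element of `G`. -/
abbrev mat (g : G) : Matrix (Fin n) (Fin n) ℝ := ((g : GL (Fin n) ℝ) : Matrix (Fin n) (Fin n) ℝ)

theorem mat_mul (g h : G) : mat (g * h) = mat g * mat h := rfl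

@[simp] theorem mat_one : mat (1 : G) = 1 := rfl

@[simp] theorem mat_mul_inv (g : G) : mat g * mat g⁻¹ = 1 := by
  rw [← mat_mul, mul_inv_cancel, mat_one]

@[simp] theorem mat_inv_mul (g : G) : mat g⁻¹ * mat g = 1 := by
  rw [← mat_mul, inv_mul_cancel, mat_one]

theorem mat_injective : Function.Injective (mat : G → Matrix (Fin n) (Fin n) ℝ) :=
  fun _ _ h => Subtype.ext (Units.ext h)

theorem mat_expG (X : lieAlg G) (h : ℝ) :
    mat (expG X h) = NormedSpace.exp (h • (X : Matrix (Fin n) (Fin n) ℝ)) := rfl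

theorem expG_zero (X : lieAlg G) : expG X 0 = 1 :=
  mat_injective (by rw [mat_expG, zero_smul, NormedSpace.exp_zero, mat_one])

theorem expG_add (X : lieAlg G) (s t : ℝ) : expG X (s + t) = expG X s * expG X t :=
  mat_injective (by
    rw [mat_mul, mat_expG, mat_expG, mat_expG, add_smul]
    exact Matrix.exp_add_of_commute _ _ (((Commute.refl _).smul_left s).smul_right t))

theorem expG_inv (X : lieAlg G) (s : ℝ) : (expG X s)⁻¹ = expG X (-s) := by
  rw [inv_eq_iff_mul_eq_one, ← expG_add, add_neg_cancel, expG_zero]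

theorem contDiff_mat_expG (X : lieAlg G) : ContDiff ℝ ∞ fun h => mat (expG X h) := by
  simp only [mat_expG]
  have h1 : ContDiff ℝ ∞
      (NormedSpace.exp : Matrix (Fin n) (Fin n) ℝ → Matrix (Fin n) (Fin n) ℝ) :=
    contDiff_iff_contDiffAt.2 fun x => (NormedSpace.exp_analytic (𝕂 := ℝ) x).contDiffAt
  exact h1.comp (contDiff_id.smul contDiff_const)

theorem hasDerivAt_mat_expG (X : lieAlg G) (h : ℝ) :
    HasDerivAt (fun h => mat (expG X h)) ((X : Matrix (Fin n) (Fin n) ℝ) * mat (expG X h)) h := by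
  simp only [mat_expG]
  exact hasDerivAt_exp_smul_const' _ h

theorem norm_leftRegular_le (hGM : Preserves G M) (g : G) (φ : C₀(M, ℂ)) :
    ‖leftRegular hGM g φ‖ ≤ ‖φ‖ :=
  norm_le_of_forall (norm_nonneg _) fun _ => norm_apply_le φ _

theorem leftRegular_gp (hM : IsClosed M) (hGM : Preserves G M) (g : G)
    (p : MvPolynomial (Fin n) ℂ) (m : M) :
    leftRegular hGM g (gp hM p) m = gaussFun p ((mat g⁻¹).mulVec m) := rfl

/-- Strong continuity of the left regular representation. -/
theorem continuous_leftRegular {T : Type*} [TopologicalSpace T] (hM : IsClosed M)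
    (hGM : Preserves G M) {g : T → G} (hg : Continuous fun t => mat (g t))
    (hg' : Continuous fun t => mat (g t)⁻¹) (φ : C₀(M, ℂ)) :
    Continuous fun t => leftRegular hGM (g t) φ := by
  have hact : Continuous fun z : T × M => φ (actHomeo hGM (g z.1)⁻¹ z.2) := by
    refine φ.continuous.comp (Continuous.subtype_mk ?_ _)
    exact (hg'.comp continuous_fst).matrix_mulVec (continuous_subtype_val.comp continuous_snd)
  rw [continuous_iff_continuousAt]
  intro t₀
  refine Metric.tendsto_nhds.2 fun ε hε => ?_
  have h0 : ∀ᶠ m in cocompact M, ‖φ m‖ < ε / 4 := by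
    simpa using (Metric.tendsto_nhds.1 φ.zero_at_infty') (ε / 4) (by positivity)
  obtain ⟨K, hK, hKφ⟩ := mem_cocompact.1 h0
  obtain ⟨R, hR⟩ := (hK.image continuous_subtype_val).isBounded.exists_norm_le
  have hsmall : ∀ m : M, R < ‖(m : Fin n → ℝ)‖ → ‖φ m‖ < ε / 4 := fun m hm =>
    hKφ fun hmK => absurd (hR m ⟨m, hmK, rfl⟩) (not_le.2 hm)
  set c := ‖mat (g t₀)‖ + 1 with hc
  have hc0 : 0 < c := by positivity
  have hb : ∀ᶠ t in 𝓝 t₀, ‖mat (g t)‖ < c :=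
    (hg.norm.tendsto t₀).eventually_lt_const (by rw [hc]; exact lt_add_one _)
  -- translates of `φ` are small outside a common compact set, since `g t` stretches by at most `c`
  have hfar : ∀ t, ‖mat (g t)‖ < c → ∀ m : M, c * max R 0 < ‖(m : Fin n → ℝ)‖ →
      ‖φ (actHomeo hGM (g t)⁻¹ m)‖ < ε / 4 := by
    intro t ht m hm
    apply hsmall
    change R < ‖(mat (g t)⁻¹).mulVec (m : Fin n → ℝ)‖
    have h1 : ‖(m : Fin n → ℝ)‖ ≤ c * ‖(mat (g t)⁻¹).mulVec (m : Fin n → ℝ)‖ := by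
      calc ‖(m : Fin n → ℝ)‖ = ‖(mat (g t)).mulVec ((mat (g t)⁻¹).mulVec (m : Fin n → ℝ))‖ := by
            rw [Matrix.mulVec_mulVec, mat_mul_inv, Matrix.one_mulVec]
        _ ≤ ‖mat (g t)‖ * ‖(mat (g t)⁻¹).mulVec (m : Fin n → ℝ)‖ :=
            Matrix.linfty_opNorm_mulVec _ _
        _ ≤ _ := by gcongr
    exact (le_max_left _ _).trans_lt (lt_of_mul_lt_mul_left (hm.trans_le h1) hc0.le)
  have hKc : IsCompact {m : M | ‖(m : Fin n → ℝ)‖ ≤ c * max R 0} := by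
    have := hM.isClosedEmbedding_subtypeVal.isCompact_preimage
      (isCompact_closedBall (0 : Fin n → ℝ) (c * max R 0))
    convert this using 1
    ext m; simp
  have hnear : ∀ᶠ t in 𝓝 t₀, ∀ m ∈ {m : M | ‖(m : Fin n → ℝ)‖ ≤ c * max R 0},
      ‖φ (actHomeo hGM (g t)⁻¹ m) - φ (actHomeo hGM (g t₀)⁻¹ m)‖ < ε / 2 := by
    refine hKc.eventually_forall_of_forall_eventually fun m _ => ?_
    have h2 : Continuous fun z : T × M =>
        ‖φ (actHomeo hGM (g z.1)⁻¹ z.2) - φ (actHomeo hGM (g t₀)⁻¹ z.2)‖ :=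
      (hact.sub (hact.comp (continuous_const.prodMk continuous_snd))).norm
    have h3 := (h2.tendsto (t₀, m)).eventually_lt_const
      (show _ < ε / 2 by simpa using hε)
    exact h3
  filter_upwards [hb, hnear] with t ht1 ht2
  rw [dist_eq_norm]
  refine lt_of_le_of_lt (norm_le_of_forall (half_pos hε).le fun m => ?_) (half_lt_self hε)
  rw [ZeroAtInftyContinuousMap.sub_apply, leftRegular_apply, leftRegular_apply]
  by_cases hm : ‖(m : Fin n → ℝ)‖ ≤ c * max R 0
  · exact (ht2 m hm).le
  · have h4 := hfar t ht1 m (not_le.1 hm)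
    have h5 := hfar t₀ (by rw [hc]; exact lt_add_one _) m (not_le.1 hm)
    exact (norm_sub_le _ _).trans (by linarith)

/-- `φ` is in the domain of `dπ(X)`, and `dπ(X) φ = ψ`. -/
def IsGen (hGM : Preserves G M) (X : lieAlg G) (φ ψ : C₀(M, ℂ)) : Prop :=
  HasDerivAt (fun h : ℝ => leftRegular hGM (expG X h) φ) ψ 0

theorem IsGen.hasDerivAt {hGM : Preserves G M} {X : lieAlg G} {φ ψ : C₀(M, ℂ)}
    (h : IsGen hGM X φ ψ) (s : ℝ) :
    HasDerivAt (fun h : ℝ => leftRegular hGM (expG X h) φ) (leftRegular hGM (expG X s) ψ) s := by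
  have h1 : HasDerivAt (fun h : ℝ => leftRegular hGM (expG X h) φ) ψ (s - s) := by
    rw [sub_self]; exact h
  have h2 := h1.comp_sub_const s s
  have h3 := ((leftRegular hGM (expG X s)).restrictScalars ℝ).hasFDerivAt.comp_hasDerivAt s h2
  refine h3.congr_of_eventuallyEq (Eventually.of_forall fun t => ?_)
  have : expG X t = expG X s * expG X (t - s) := by rw [← expG_add, add_sub_cancel]
  simp only [Function.comp_apply, this, map_mul]
  rfl

theorem continuous_leftRegular_expG (hM : IsClosed M) (hGM : Preserves G M) (X : lieAlg G)
    (φ : C₀(M, ℂ)) : Continuous fun h => leftRegular hGM (expG X h) φ := by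
  refine continuous_leftRegular hM hGM (contDiff_mat_expG X).continuous ?_ φ
  simp only [expG_inv]
  exact (contDiff_mat_expG X).continuous.comp continuous_neg

/-- If the derivative of `h ↦ φ(e^{-hX} m)` at `0` exists at every point `m` and is a function in
`C₀(M)` of `m`, then it exists uniformly in `m`. -/
theorem isGen_of_forall (hM : IsClosed M) {hGM : Preserves G M} {X : lieAlg G} {φ ψ : C₀(M, ℂ)}
    (h : ∀ m, HasDerivAt (fun h : ℝ => leftRegular hGM (expG X h) φ m) (ψ m) 0) :
    IsGen hGM X φ ψ := by
  have hs : ∀ m s, HasDerivAt (fun h : ℝ => leftRegular hGM (expG X h) φ m)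
      (leftRegular hGM (expG X s) ψ m) s := by
    intro m s
    have h1 : HasDerivAt (fun h : ℝ => leftRegular hGM (expG X h) φ
        (actHomeo hGM (expG X s)⁻¹ m)) (leftRegular hGM (expG X s) ψ m) (s - s) := by
      rw [sub_self]; exact h _
    have h2 := h1.comp_sub_const s s
    refine h2.congr_of_eventuallyEq (Eventually.of_forall fun t => ?_)
    have : expG X t = expG X s * expG X (t - s) := by rw [← expG_add, add_sub_cancel]
    simp only [this, map_mul]
    rfl
  rw [IsGen, hasDerivAt_iff_isLittleO, Asymptotics.isLittleO_iff]
  intro c hc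
  have hcont := (continuous_leftRegular_expG hM hGM X ψ).tendsto 0
  obtain ⟨δ, hδ, hball⟩ := Metric.eventually_nhds_iff.1 (Metric.tendsto_nhds.1 hcont c hc)
  rw [expG_zero, map_one] at hball
  refine Metric.eventually_nhds_iff.2 ⟨δ, hδ, fun t ht => norm_le_of_forall (by positivity)
    fun m => ?_⟩
  have hd : ∀ s ∈ Set.uIcc 0 t, HasDerivWithinAt
      (fun h : ℝ => leftRegular hGM (expG X h) φ m - h • ψ m)
      (leftRegular hGM (expG X s) ψ m - ψ m) (Set.uIcc 0 t) s := fun s _ => by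
    have := (hs m s).sub ((hasDerivAt_id s).smul_const (ψ m))
    rw [one_smul] at this
    exact this.hasDerivWithinAt
  have hbd : ∀ s ∈ Set.uIcc 0 t, ‖leftRegular hGM (expG X s) ψ m - ψ m‖ ≤ c := by
    intro s hsI
    have h1 : dist s 0 < δ := by
      rw [Real.dist_eq, sub_zero] at ht ⊢
      have := Set.abs_sub_left_of_mem_uIcc hsI
      simp only [sub_zero] at this
      exact this.trans_lt ht
    have h2 := hball h1
    rw [dist_eq_norm] at h2
    exact (norm_apply_le (leftRegular hGM (expG X s) ψ - ψ) m).trans h2.le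
  have := (convex_uIcc (0 : ℝ) t).norm_image_sub_le_of_norm_hasDerivWithin_le hd hbd
    Set.left_mem_uIcc Set.right_mem_uIcc
  simp only [zero_smul, sub_zero] at this
  simp only [sub_zero]
  refine le_trans (le_of_eq ?_) this
  congr 1
  simp only [ZeroAtInftyContinuousMap.sub_apply, ZeroAtInftyContinuousMap.smul_apply]
  ring

/-- If `γ` has derivative `-Z γ(0)`, then `p e^{-r²}` along `γ` has derivative
`(gaussDer Z p) e^{-r²}`. -/
theorem hasDerivAt_gaussFun_comp {γ : ℝ → Fin n → ℝ} {Z : Matrix (Fin n) (Fin n) ℝ}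
    (hγ : HasDerivAt γ (-Z.mulVec (γ 0)) 0) (p : MvPolynomial (Fin n) ℂ) :
    HasDerivAt (fun h => gaussFun p (γ h)) (gaussFun (gaussDer Z p) (γ 0)) 0 := by
  have h1 := ((contDiff_gaussFun p).differentiable (by simp) (γ 0)).hasFDerivAt
  have := h1.comp_hasDerivAt 0 hγ
  rw [fderiv_gaussFun] at this
  exact this

theorem hasDerivAt_mulVec {T : ℝ → Matrix (Fin n) (Fin n) ℝ} {T' : Matrix (Fin n) (Fin n) ℝ}
    {s : ℝ} (hT : HasDerivAt T T' s) (x : Fin n → ℝ) :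
    HasDerivAt (fun h => (T h).mulVec x) (T'.mulVec x) s := by
  let ℓ : Matrix (Fin n) (Fin n) ℝ →ₗ[ℝ] (Fin n → ℝ) :=
    { toFun := fun A => A.mulVec x
      map_add' := fun A B => Matrix.add_mulVec A B x
      map_smul' := fun c A => Matrix.smul_mulVec c A x }
  exact ℓ.toContinuousLinearMap.hasFDerivAt.comp_hasDerivAt s hT

/-- Translates of `p e^{-r²}` are in the domain of every `dπ(X)`. -/
theorem isGen_leftRegular_gp (hM : IsClosed M) (hGM : Preserves G M) (X : lieAlg G) (g : G)
    (p : MvPolynomial (Fin n) ℂ) :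
    IsGen hGM X (leftRegular hGM g (gp hM p))
      (leftRegular hGM g (gp hM (gaussDer (mat g⁻¹ * X * mat g) p))) := by
  refine isGen_of_forall hM fun m => ?_
  have h0 : HasDerivAt (fun h => mat (expG X (-h))) (-(X : Matrix (Fin n) (Fin n) ℝ)) 0 := by
    have h1 : HasDerivAt (fun h => mat (expG X h)) ((X : Matrix (Fin n) (Fin n) ℝ)) (-0) := by
      have := hasDerivAt_mat_expG X 0
      rw [expG_zero, mat_one, mul_one] at this
      rwa [neg_zero]
    have := h1.scomp (0 : ℝ) (hasDerivAt_neg (0 : ℝ))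
    rw [neg_one_smul] at this
    exact this
  have h2 : HasDerivAt (fun h => (mat g⁻¹).mulVec ((mat (expG X (-h))).mulVec (m : Fin n → ℝ)))
      (-(mat g⁻¹ * X * mat g).mulVec
        ((mat g⁻¹).mulVec ((mat (expG X (-0))).mulVec (m : Fin n → ℝ)))) 0 := by
    have h3 := hasDerivAt_mulVec h0 (m : Fin n → ℝ)
    have h4 := (Matrix.mulVecLin (mat g⁻¹)).toContinuousLinearMap.hasFDerivAt.comp_hasDerivAt 0 h3
    have h5 : -(mat g⁻¹ * X * mat g).mulVec
        ((mat g⁻¹).mulVec ((mat (expG X (-0))).mulVec (m : Fin n → ℝ))) =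
        (mat g⁻¹).mulVec ((-(X : Matrix (Fin n) (Fin n) ℝ)).mulVec (m : Fin n → ℝ)) := by
      rw [neg_zero, expG_zero, mat_one, Matrix.one_mulVec, Matrix.mulVec_mulVec, Matrix.mul_assoc,
        mat_mul_inv, mul_one, Matrix.neg_mulVec, Matrix.mulVec_neg, Matrix.mulVec_mulVec]
    rw [h5]
    exact h4
  have h5 := hasDerivAt_gaussFun_comp h2 p
  simp only [neg_zero, expG_zero, mat_one, Matrix.one_mulVec] at h5
  rw [leftRegular_gp]
  refine h5.congr_of_eventuallyEq (Eventually.of_forall fun h => ?_)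
  change leftRegular hGM g (gp hM p) (actHomeo hGM (expG X h)⁻¹ m) = _
  rw [leftRegular_gp, expG_inv]
  rfl

theorem isGen_gp (hM : IsClosed M) (hGM : Preserves G M) (X : lieAlg G)
    (p : MvPolynomial (Fin n) ℂ) : IsGen hGM X (gp hM p) (gp hM (gaussDer X p)) := by
  have := isGen_leftRegular_gp hM hGM X 1 p
  rw [inv_one, mat_one, one_mul, mul_one, map_one] at this
  exact this

theorem isClosed_isGen (hGM : Preserves G M) (X : lieAlg G) :
    IsClosed {z : C₀(M, ℂ) × C₀(M, ℂ) | IsGen hGM X z.1 z.2} := by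
  refine isClosed_of_closure_subset fun z hz => ?_
  obtain ⟨u, hu, hlim⟩ := mem_closure_iff_seq_limit.1 hz
  have h1 : Tendsto (fun k => (u k).1) atTop (𝓝 z.1) := (continuous_fst.tendsto z).comp hlim
  have h2 : Tendsto (fun k => (u k).2) atTop (𝓝 z.2) := (continuous_snd.tendsto z).comp hlim
  have h3 := hasDerivAt_of_tendstoUniformly (l := atTop)
    (f := fun k h => leftRegular hGM (expG X h) (u k).1)
    (f' := fun k h => leftRegular hGM (expG X h) (u k).2)
    (g := fun h => leftRegular hGM (expG X h) z.1)
    (g' := fun h => leftRegular hGM (expG X h) z.2) ?_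
    (Eventually.of_forall fun k => (hu k).hasDerivAt)
    (fun h => ((leftRegular hGM (expG X h)).continuous.tendsto _).comp h1) 0
  · simp only [expG_zero, map_one] at h3
    exact h3
  · refine Metric.tendstoUniformly_iff.2 fun ε hε => ?_
    filter_upwards [Metric.tendsto_nhds.1 h2 ε hε] with k hk h
    rw [dist_comm, dist_eq_norm, ← map_sub]
    rw [dist_eq_norm] at hk
    exact (norm_leftRegular_le hGM _ _).trans_lt hk

/-! ### Translates of polynomials times a Gaussian -/

/-- `p ↦ gaussDer Z p` as a linear map. -/
def gaussDerLin (Z : Matrix (Fin n) (Fin n) ℝ) :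
    MvPolynomial (Fin n) ℂ →ₗ[ℂ] MvPolynomial (Fin n) ℂ :=
  (linDer Z : MvPolynomial (Fin n) ℂ →ₗ[ℂ] MvPolynomial (Fin n) ℂ) -
    LinearMap.mulRight ℂ (linDer Z (rsqPoly n))

/-- The joint graph of the first-order operators given by the linear vector fields `-Z i`, on the
space of the `p e^{-r²}`. -/
def polyGraph (hM : IsClosed M) (Z : ι → Matrix (Fin n) (Fin n) ℝ) :
    Submodule ℂ (C₀(M, ℂ) × (ι → C₀(M, ℂ))) :=
  LinearMap.range ((gpLin hM).prod (LinearMap.pi fun i => gpLin hM ∘ₗ gaussDerLin (Z i)))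

theorem mem_polyGraph (hM : IsClosed M) (Z : ι → Matrix (Fin n) (Fin n) ℝ)
    (z : C₀(M, ℂ) × (ι → C₀(M, ℂ))) :
    z ∈ polyGraph hM Z ↔ ∃ p, z = (gp hM p, fun i => gp hM (gaussDer (Z i) p)) := by
  constructor
  · rintro ⟨p, rfl⟩
    exact ⟨p, rfl⟩
  · rintro ⟨p, rfl⟩
    exact ⟨p, rfl⟩

/-- The polynomial `p ∘ A`, for a matrix `A`. -/
def compLin (A : Matrix (Fin n) (Fin n) ℝ) (p : MvPolynomial (Fin n) ℂ) :
    MvPolynomial (Fin n) ℂ :=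
  MvPolynomial.aeval (fun i => ∑ j, MvPolynomial.C (A i j : ℂ) * MvPolynomial.X j) p

theorem evalR_compLin (A : Matrix (Fin n) (Fin n) ℝ) (p : MvPolynomial (Fin n) ℂ)
    (x : Fin n → ℝ) : evalR x (compLin A p) = evalR (A.mulVec x) p := by
  induction p using MvPolynomial.induction_on with
  | C a => simp [compLin]
  | add p q hp hq => simpa [compLin] using congrArg₂ (· + ·) hp hq
  | mul_X p i hp =>
    have hi : evalR x (∑ j, MvPolynomial.C (A i j : ℂ) * MvPolynomial.X j) =
        (A.mulVec x i : ℂ) := by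
      simp [Matrix.mulVec, dotProduct]
    simp only [compLin] at hp ⊢
    rw [map_mul, map_mul, hp, MvPolynomial.aeval_X, hi, map_mul, evalR_X]

theorem linDer_expSum (Z : Matrix (Fin n) (Fin n) ℝ) (B : MvPolynomial (Fin n) ℂ) (N : ℕ) :
    linDer Z (expSum B (N + 1)) = linDer Z B * expSum B N := by
  rw [expSum, Finset.sum_range_succ', map_add, map_sum, expSum, Finset.mul_sum]
  simp only [pow_zero, mul_one, MvPolynomial.derivation_C, add_zero]
  refine Finset.sum_congr rfl fun l _ => ?_
  rw [Derivation.leibniz, MvPolynomial.derivation_C, Derivation.leibniz_pow, smul_zero, add_zero,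
    Nat.add_sub_cancel, nsmul_eq_mul, smul_eq_mul, smul_eq_mul, Nat.factorial_succ]
  have h : MvPolynomial.C (σ := Fin n) ((((l + 1) * l.factorial : ℕ) : ℂ)⁻¹) *
      ((l + 1 : ℕ) : MvPolynomial (Fin n) ℂ) = MvPolynomial.C ((l.factorial : ℂ)⁻¹) := by
    rw [← map_natCast (MvPolynomial.C (σ := Fin n) (R := ℂ)), ← map_mul]
    congr 1
    push_cast
    have : (l : ℂ) + 1 ≠ 0 := by exact_mod_cast l.succ_ne_zero
    field_simp
  rw [← mul_assoc, h]
  ring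

theorem gaussDer_mul_expSum (Z : Matrix (Fin n) (Fin n) ℝ) (q B : MvPolynomial (Fin n) ℂ)
    (N : ℕ) : gaussDer Z (q * expSum B (N + 1)) =
      gaussDer Z q * expSum B (N + 1) + q * linDer Z B * expSum B N := by
  rw [gaussDer, gaussDer, Derivation.leibniz, linDer_expSum, smul_eq_mul, smul_eq_mul]
  ring

/-- If `g` is close to `1`, in the sense that `|r² - r² ∘ g⁻¹| ≤ r² / 4`, then the translate of
`p e^{-r²}` by `g` and its derivatives are approximated simultaneously by polynomials times the
Gaussian `e^{-r²}`, through the power series of `e^{r² - r² ∘ g⁻¹}`. -/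
theorem leftRegular_gp_mem (hM : IsClosed M) (hGM : Preserves G M) (X : ι → lieAlg G) (g : G)
    (hg : ∀ x, |rsq x - rsq ((mat g⁻¹).mulVec x)| ≤ rsq x / 4) (p : MvPolynomial (Fin n) ℂ) :
    (leftRegular hGM g (gp hM p),
      fun i => leftRegular hGM g (gp hM (gaussDer (mat g⁻¹ * (X i) * mat g) p))) ∈
      (polyGraph hM fun i => (X i : Matrix (Fin n) (Fin n) ℝ)).topologicalClosure := by
  set B := rsqPoly n - compLin (mat g⁻¹) (rsqPoly n) with hBdef
  have hB : ∀ x, evalR x B = ((rsq x - rsq ((mat g⁻¹).mulVec x) : ℝ) : ℂ) := fun x => by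
    rw [hBdef, map_sub, evalR_compLin, evalR_rsqPoly, evalR_rsqPoly, Complex.ofReal_sub]
  have hval : ∀ (q : MvPolynomial (Fin n) ℂ) (m : M), leftRegular hGM g (gp hM q) m =
      evalR (m : Fin n → ℝ) (compLin (mat g⁻¹) q) *
        (Real.exp (rsq (m : Fin n → ℝ) - rsq ((mat g⁻¹).mulVec m) - rsq (m : Fin n → ℝ)) : ℂ) := by
    intro q m
    rw [leftRegular_gp, gaussFun, evalR_compLin]
    congr 3
    ring
  have hlim : ∀ q, Tendsto (fun N => gp hM (q * expSum B N)) atTop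
      (𝓝 (leftRegular hGM g (gp hM (compLin (mat g) q)))) := by
    intro q
    refine tendsto_gp_mul_expSum hM q B _ hB hg _ fun m => ?_
    rw [hval, evalR_compLin, evalR_compLin, Matrix.mulVec_mulVec, mat_mul_inv, Matrix.one_mulVec]
  set q := compLin (mat g⁻¹) p with hq
  have h1 : Tendsto (fun N => gp hM (q * expSum B (N + 1))) atTop
      (𝓝 (leftRegular hGM g (gp hM p))) := by
    exact (tendsto_gp_mul_expSum hM q B _ hB hg _ fun m => hval p m).comp
      (tendsto_add_atTop_nat 1)
  have h2 : ∀ i, ∃ χ, Tendsto (fun N => gp hM (gaussDer (X i) (q * expSum B (N + 1)))) atTop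
      (𝓝 χ) := by
    intro i
    refine ⟨_, Tendsto.congr (fun N => ?_)
      (((hlim (gaussDer (X i) q)).comp (tendsto_add_atTop_nat 1)).add
        (hlim (q * linDer (X i) B)))⟩
    rw [gaussDer_mul_expSum]
    exact ((gpLin hM).map_add _ _).symm
  -- the limits are the derivatives of the translate, because the graph of `dπ(X i)` is closed
  have h3 : ∀ i, Tendsto (fun N => gp hM (gaussDer (X i) (q * expSum B (N + 1)))) atTop
      (𝓝 (leftRegular hGM g (gp hM (gaussDer (mat g⁻¹ * (X i) * mat g) p)))) := by
    intro i
    obtain ⟨χ, hχ⟩ := h2 i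
    have h4 : IsGen hGM (X i) (leftRegular hGM g (gp hM p)) χ :=
      (isClosed_isGen hGM (X i)).mem_of_tendsto (h1.prodMk_nhds hχ)
        (Eventually.of_forall fun N => isGen_gp hM hGM (X i) _)
    rwa [h4.unique (isGen_leftRegular_gp hM hGM (X i) g p)] at hχ
  exact mem_closure_of_tendsto (h1.prodMk_nhds (tendsto_pi_nhds.2 h3))
    (Eventually.of_forall fun N => (mem_polyGraph hM _ _).2 ⟨_, rfl⟩)

theorem abs_rsq_sub_le {A : Matrix (Fin n) (Fin n) ℝ} (hA : ‖A - 1‖ ≤ 1 / (12 * (n + 1)))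
    (x : Fin n → ℝ) : |rsq x - rsq (A.mulVec x)| ≤ rsq x / 4 := by
  have hn : (0 : ℝ) < n + 1 := by positivity
  set y := (A - 1).mulVec x with hy
  have hy1 : ‖y‖ ≤ 1 / (12 * (n + 1)) * ‖x‖ :=
    (Matrix.linfty_opNorm_mulVec _ _).trans (mul_le_mul_of_nonneg_right hA (norm_nonneg _))
  have hAx : ∀ i, A.mulVec x i = x i + y i := fun i => by
    rw [hy, Matrix.sub_mulVec, Matrix.one_mulVec, Pi.sub_apply]; ring
  have hle1 : 1 / (12 * ((n : ℝ) + 1)) ≤ 1 := by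
    rw [div_le_one (by positivity)]
    have : (0 : ℝ) ≤ n := n.cast_nonneg
    linarith
  have hy2 : ‖y‖ ≤ ‖x‖ := hy1.trans (mul_le_of_le_one_left (norm_nonneg _) hle1)
  have hterm : ∀ i, |x i ^ 2 - A.mulVec x i ^ 2| ≤ 1 / (12 * (n + 1)) * 3 * rsq x := by
    intro i
    have e : x i ^ 2 - A.mulVec x i ^ 2 = -(y i * (2 * x i + y i)) := by rw [hAx]; ring
    have hx := norm_le_pi_norm x i
    have hyi := norm_le_pi_norm y i
    rw [e, abs_neg, abs_mul]
    rw [Real.norm_eq_abs] at hx hyi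
    have h2 : |2 * x i + y i| ≤ 3 * ‖x‖ := by
      refine (abs_add_le _ _).trans ?_
      rw [abs_mul, abs_two]
      linarith
    calc |y i| * |2 * x i + y i| ≤ (1 / (12 * (n + 1)) * ‖x‖) * (3 * ‖x‖) := by
          gcongr
          exact hyi.trans hy1
      _ = 1 / (12 * (n + 1)) * 3 * ‖x‖ ^ 2 := by ring
      _ ≤ _ := by gcongr; exact sq_norm_le_rsq x
  calc |rsq x - rsq (A.mulVec x)| = |∑ i, (x i ^ 2 - A.mulVec x i ^ 2)| := by
        rw [Finset.sum_sub_distrib]; rfl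
    _ ≤ ∑ i, |x i ^ 2 - A.mulVec x i ^ 2| := Finset.abs_sum_le_sum_abs _ _
    _ ≤ ∑ _i : Fin n, 1 / (12 * ((n : ℝ) + 1)) * 3 * rsq x := Finset.sum_le_sum fun i _ => hterm i
    _ = n / (n + 1) * (rsq x / 4) := by
      rw [Finset.sum_const, Finset.card_univ, Fintype.card_fin, nsmul_eq_mul]
      field_simp
      ring
    _ ≤ 1 * (rsq x / 4) := by
      have := rsq_nonneg x
      gcongr
      rw [div_le_one hn]
      linarith
    _ = _ := one_mul _

/-- Near a parameter at which a continuous family in `G` is `1`, `leftRegular_gp_mem` applies. -/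
theorem eventually_abs_rsq_sub_le {T : Type*} [TopologicalSpace T] {g : T → G} {t₀ : T}
    (hg' : Continuous fun t => mat (g t)⁻¹) (h1 : g t₀ = 1) :
    ∀ᶠ t in 𝓝 t₀, ∀ x, |rsq x - rsq ((mat (g t)⁻¹).mulVec x)| ≤ rsq x / 4 := by
  have h2 : Tendsto (fun t => ‖mat (g t)⁻¹ - 1‖) (𝓝 t₀) (𝓝 0) := by
    have h3 : Continuous fun t => ‖mat (g t)⁻¹ - 1‖ := (hg'.sub continuous_const).norm
    have := h3.tendsto t₀
    rwa [h1, inv_one, mat_one, sub_self, norm_zero] at this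
  filter_upwards [h2.eventually_lt_const (show (0 : ℝ) < 1 / (12 * (n + 1)) by positivity)]
    with t ht
  exact abs_rsq_sub_le ht.le

/-! ### Averages of translates -/

/-- The integral of a function with values in a closed subspace lies in the subspace. -/
theorem integral_mem_of_isClosed {T E : Type*} [MeasurableSpace T] {μ : Measure T}
    [NormedAddCommGroup E] [NormedSpace ℝ E] [CompleteSpace E] {K : Submodule ℝ E}
    (hK : IsClosed (K : Set E)) {f : T → E} (hf : Integrable f μ) (h : ∀ᵐ t ∂μ, f t ∈ K) :
    ∫ t, f t ∂μ ∈ K := by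
  have : IsClosed (K : Set E) := hK
  rw [← Submodule.Quotient.mk_eq_zero]
  have h1 := (K.mkQL).integral_comp_comm hf
  have h2 : ∫ t, K.mkQL (f t) ∂μ = 0 :=
    integral_eq_zero_of_ae (h.mono fun t ht => (Submodule.Quotient.mk_eq_zero K).2 ht)
  rw [h2] at h1
  exact h1.symm

/-- The average `∫ k(t) π(g(t)) φ dμ(t)` of the translates of `φ`. -/
def wavg {T : Type*} [MeasurableSpace T] (hGM : Preserves G M) (μ : Measure T) (k : T → ℝ)
    (g : T → G) (φ : C₀(M, ℂ)) : C₀(M, ℂ) :=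
  ∫ t, k t • leftRegular hGM (g t) φ ∂μ

theorem continuous_wavg {T : Type*} [MeasurableSpace T] {hGM : Preserves G M} {μ : Measure T}
    {k : T → ℝ} {g : T → G} (hk : Integrable k μ)
    (hint : ∀ φ, Integrable (fun t => k t • leftRegular hGM (g t) φ) μ) :
    Continuous (wavg hGM μ k g) := by
  refine (LipschitzWith.of_dist_le_mul (K := (∫ t, ‖k t‖ ∂μ).toNNReal) fun φ ψ => ?_).continuous
  rw [dist_eq_norm, dist_eq_norm, wavg, wavg, ← integral_sub (hint φ) (hint ψ),
    Real.coe_toNNReal _ (integral_nonneg fun _ => norm_nonneg _), ← integral_mul_const]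
  refine norm_integral_le_of_norm_le (hk.norm.mul_const _) (Eventually.of_forall fun t => ?_)
  have h1 : k t • leftRegular hGM (g t) φ - k t • leftRegular hGM (g t) ψ =
      k t • leftRegular hGM (g t) (φ - ψ) := by
    rw [map_sub]
    exact (smul_sub (k t) (leftRegular hGM (g t) φ) (leftRegular hGM (g t) ψ)).symm
  rw [h1, norm_smul]
  exact mul_le_mul_of_nonneg_left (norm_leftRegular_le hGM _ _) (norm_nonneg _)

/-- The evaluation at `m`, as a real continuous linear functional. -/
def evalCLM (m : M) : C₀(M, ℂ) →L[ℝ] ℂ :=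
  LinearMap.mkContinuous
    { toFun := fun φ => φ m, map_add' := fun _ _ => rfl, map_smul' := fun _ _ => rfl } 1
    fun φ => by rw [one_mul]; exact norm_apply_le φ m

@[simp] theorem evalCLM_apply (m : M) (φ : C₀(M, ℂ)) : evalCLM m φ = φ m := rfl

theorem wavg_apply {T : Type*} [MeasurableSpace T] {hGM : Preserves G M} {μ : Measure T}
    {k : T → ℝ} {g : T → G} {φ : C₀(M, ℂ)}
    (hint : Integrable (fun t => k t • leftRegular hGM (g t) φ) μ) (m : M) :
    wavg hGM μ k g φ m = ∫ t, k t • leftRegular hGM (g t) φ m ∂μ :=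
  ((evalCLM m).integral_comp_comm hint).symm

/-! ### The core property for a single generator -/

/-- Every element of the graph of `dπ(X)` is a limit of elements `(p e^{-r²}, dπ(X) (p e^{-r²}))`.
The averages `h⁻¹ ∫₀ʰ π(e^{sX}) φ ds` are such limits by `leftRegular_gp_mem`, for every `φ` by
density, and together with their derivatives `h⁻¹ (π(e^{hX}) φ - φ)` they converge as `h → 0`. -/
theorem IsGen.mem_closure_polyGraph (hM : IsClosed M) {hGM : Preserves G M} {X : lieAlg G}
    {φ ψ : C₀(M, ℂ)} (hφ : IsGen hGM X φ ψ) :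
    (φ, fun _ : Unit => ψ) ∈
      (polyGraph hM fun _ : Unit => (X : Matrix (Fin n) (Fin n) ℝ)).topologicalClosure := by
  set K := (polyGraph hM fun _ : Unit => (X : Matrix (Fin n) (Fin n) ℝ)).topologicalClosure with hKd
  have hK : IsClosed (K : Set (C₀(M, ℂ) × (Unit → C₀(M, ℂ)))) :=
    Submodule.isClosed_topologicalClosure _
  have hKr : IsClosed (K.restrictScalars ℝ : Set (C₀(M, ℂ) × (Unit → C₀(M, ℂ)))) := hK
  have hc := continuous_leftRegular_expG hM hGM X
  obtain ⟨δ, hδ, hnear⟩ := Metric.eventually_nhds_iff.1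
    (eventually_abs_rsq_sub_le (g := expG X) (t₀ := 0)
      (by simp only [expG_inv]; exact (contDiff_mat_expG X).continuous.comp continuous_neg)
      (expG_zero X))
  have hmem : ∀ h, 0 < h → h < δ → ∀ χ : C₀(M, ℂ),
      (∫ s in (0 : ℝ)..h, leftRegular hGM (expG X s) χ,
        fun _ : Unit => leftRegular hGM (expG X h) χ - χ) ∈ K := by
    intro h h0 hhδ χ
    have hcont : Continuous fun χ : C₀(M, ℂ) =>
        ∫ s in (0 : ℝ)..h, leftRegular hGM (expG X s) χ := by
      have := continuous_wavg (hGM := hGM) (μ := volume.restrict (Set.Ioc 0 h)) (k := fun _ => 1)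
        (g := expG X) (integrable_const _) fun φ => by
          simp only [one_smul]; exact (hc φ).integrableOn_Ioc
      convert this using 2 with χ
      simp only [wavg, one_smul, intervalIntegral.integral_of_le h0.le]
    have hclosed : IsClosed {χ : C₀(M, ℂ) | (∫ s in (0 : ℝ)..h, leftRegular hGM (expG X s) χ,
        fun _ : Unit => leftRegular hGM (expG X h) χ - χ) ∈ K} := by
      refine hK.preimage (hcont.prodMk (continuous_pi fun _ => ?_))
      exact (leftRegular hGM (expG X h)).continuous.sub continuous_id
    refine hclosed.closure_subset_iff.2 ?_ (dense_gaussPoly hM χ)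
    intro χ hχ
    obtain ⟨p, rfl⟩ := (mem_gaussPoly_iff hM).1 hχ
    have hX : ∀ s, mat (expG X s)⁻¹ * (X : Matrix (Fin n) (Fin n) ℝ) * mat (expG X s) = X := by
      intro s
      have h1 : Commute (X : Matrix (Fin n) (Fin n) ℝ) (mat (expG X s)) := by
        rw [mat_expG]
        exact ((Commute.refl _).smul_right s).exp_right
      rw [mul_assoc, h1.eq, ← mul_assoc, mat_inv_mul, one_mul]
    have hf : Continuous fun s => ((leftRegular hGM (expG X s) (gp hM p),
        fun _ : Unit => leftRegular hGM (expG X s) (gp hM (gaussDer X p))) :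
          C₀(M, ℂ) × (Unit → C₀(M, ℂ))) :=
      (hc _).prodMk (continuous_pi fun _ => hc _)
    have hi := hf.integrableOn_Ioc (μ := volume) (a := 0) (b := h)
    have hm := integral_mem_of_isClosed hKr hi (by
      refine (ae_restrict_iff' measurableSet_Ioc).2 (Eventually.of_forall fun s hs => ?_)
      have h2 := leftRegular_gp_mem hM hGM (fun _ : Unit => X) (expG X s) (hnear (y := s) (by
        rw [Real.dist_eq, sub_zero, abs_of_pos hs.1]; exact hs.2.trans_lt hhδ)) p
      simp only [hX] at h2
      exact h2)
    refine (congrArg (· ∈ K) ?_).mpr hm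
    refine Prod.ext ?_ ?_
    · change _ = ContinuousLinearMap.fst ℝ _ _ _
      rw [← ContinuousLinearMap.integral_comp_comm _ hi, intervalIntegral.integral_of_le h0.le]
      rfl
    · funext u
      change _ = ((ContinuousLinearMap.proj (R := ℝ) (φ := fun _ : Unit => C₀(M, ℂ)) u).comp
        (ContinuousLinearMap.snd ℝ _ _)) _
      rw [← ContinuousLinearMap.integral_comp_comm _ hi]
      have := intervalIntegral.integral_eq_sub_of_hasDerivAt
        (fun s _ => (isGen_gp hM hGM X p).hasDerivAt s) ((hc _).intervalIntegrable 0 h)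
      rw [expG_zero, map_one, intervalIntegral.integral_of_le h0.le] at this
      exact this.symm
  have hd : HasDerivAt (fun h => ((∫ s in (0 : ℝ)..h, leftRegular hGM (expG X s) φ,
        fun _ : Unit => leftRegular hGM (expG X h) φ - φ) : C₀(M, ℂ) × (Unit → C₀(M, ℂ))))
      (φ, fun _ => ψ) 0 := by
    refine HasDerivAt.prodMk ?_ (hasDerivAt_pi.2 fun _ => HasDerivAt.sub_const φ hφ)
    have := (hc φ).integral_hasStrictDerivAt 0 0
    rw [expG_zero, map_one] at this
    exact this.hasDerivAt
  refine hK.mem_of_tendsto hd.tendsto_slope_zero_right ?_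
  filter_upwards [Ioo_mem_nhdsGT hδ] with h hh
  have := (K.restrictScalars ℝ).smul_mem h⁻¹ (hmem h hh.1 hh.2 φ)
  refine (congrArg (· ∈ K) ?_).mpr this
  simp only [zero_add, intervalIntegral.integral_same, expG_zero, map_one,
    one_apply_eq_self, sub_self]
  congr 1
  exact sub_zero _

/-! ### Coordinates of the second kind -/

/-- The Lie algebra is stable under the adjoint action of the group. -/
theorem conj_mem_lieAlg (g : G) {Z : Matrix (Fin n) (Fin n) ℝ} (hZ : Z ∈ lieAlg G) :
    mat g * Z * mat g⁻¹ ∈ lieAlg G := by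
  intro h
  have h1 : expGL (h • (mat g * Z * mat g⁻¹)) =
      ((g * expG ⟨Z, hZ⟩ h * g⁻¹ : G) : GL (Fin n) ℝ) := by
    apply Units.ext
    change NormedSpace.exp (h • (mat g * Z * mat g⁻¹)) = mat g * NormedSpace.exp (h • Z) * mat g⁻¹
    have h2 := Matrix.exp_units_conj (g : GL (Fin n) ℝ) (h • Z)
    rw [Matrix.mul_smul, Matrix.smul_mul] at h2
    exact h2
  rw [h1]
  exact (g * expG ⟨Z, hZ⟩ h * g⁻¹ : G).2

theorem conj_mem_span_lieAlg (g : G) {Z : Matrix (Fin n) (Fin n) ℝ}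
    (hZ : Z ∈ Submodule.span ℝ (lieAlg G)) :
    mat g * Z * mat g⁻¹ ∈ Submodule.span ℝ (lieAlg G) := by
  induction hZ using Submodule.span_induction with
  | mem Z hZ => exact Submodule.subset_span (conj_mem_lieAlg g hZ)
  | zero => simp
  | add Z Z' _ _ h h' => rw [mul_add, add_mul]; exact add_mem h h'
  | smul c Z _ h => rw [mul_smul_comm, smul_mul_assoc]; exact Submodule.smul_mem _ c h

/-- For `a i` in the Lie algebra, the product `F(t)` of the `e^{t_i a_i}` (in some order) is a
smooth family in `G` with `F(0) = 1` and `DF(0) y = ∑ y_i a_i`. Its right logarithmic derivative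
`DF(t) y F(t)⁻¹` has values in the span of the Lie algebra, which is stable under conjugation. -/
theorem exists_prod_exp [Fintype ι] (a : ι → lieAlg G) (s : Finset ι) :
    ∃ F : (ι → ℝ) → G, ContDiff ℝ ∞ (fun t => mat (F t)) ∧ ContDiff ℝ ∞ (fun t => mat (F t)⁻¹) ∧
      F 0 = 1 ∧
      (∀ t y, fderiv ℝ (fun t => mat (F t)) t y * mat (F t)⁻¹ ∈ Submodule.span ℝ (lieAlg G)) ∧
      ∀ y, fderiv ℝ (fun t => mat (F t)) 0 y = ∑ i ∈ s, y i • (a i : Matrix (Fin n) (Fin n) ℝ) := by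
  classical
  induction s using Finset.induction_on with
  | empty =>
    refine ⟨fun _ => 1, contDiff_const, contDiff_const, rfl, fun t y => ?_, fun y => ?_⟩
    · simp
    · simp
  | insert i s hi ih =>
    obtain ⟨F, hF, hF', hF0, hFW, hFd⟩ := ih
    have he : ContDiff ℝ ∞ fun t : ι → ℝ => mat (expG (a i) (t i)) :=
      (contDiff_mat_expG (a i)).comp (contDiff_apply ℝ ℝ i)
    have hd : ∀ t y, fderiv ℝ (fun t => mat (expG (a i) (t i) * F t)) t y =
        y i • ((a i : Matrix (Fin n) (Fin n) ℝ) * mat (expG (a i) (t i)) * mat (F t)) +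
          mat (expG (a i) (t i)) * fderiv ℝ (fun t => mat (F t)) t y := by
      intro t y
      have h1 : HasFDerivAt (fun t : ι → ℝ => mat (expG (a i) (t i)))
          ((ContinuousLinearMap.proj (R := ℝ) (φ := fun _ : ι => ℝ) i).smulRight
            ((a i : Matrix (Fin n) (Fin n) ℝ) * mat (expG (a i) (t i)))) t := by
        have := (hasDerivAt_mat_expG (a i) (t i)).hasFDerivAt.comp t
          (ContinuousLinearMap.proj (R := ℝ) (φ := fun _ : ι => ℝ) i).hasFDerivAt
        refine this.congr_fderiv ?_
        ext1 z
        rfl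
      have h2 := h1.mul' ((hF.differentiable (by simp)) t).hasFDerivAt
      have h3 := DFunLike.congr_fun h2.fderiv y
      refine h3.trans ((add_comm _ _).trans ?_)
      congr 1
      exact smul_mul_assoc _ _ _
    refine ⟨fun t => expG (a i) (t i) * F t, he.mul hF, ?_, ?_, fun t y => ?_, fun y => ?_⟩
    · simp only [mul_inv_rev, mat_mul, expG_inv]
      exact hF'.mul ((contDiff_mat_expG (a i)).comp (contDiff_apply ℝ ℝ i).neg)
    · simp [hF0, expG_zero]
    · have h3 : fderiv ℝ (fun t => mat (expG (a i) (t i) * F t)) t y *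
          mat (expG (a i) (t i) * F t)⁻¹ = y i • (a i : Matrix (Fin n) (Fin n) ℝ) +
          mat (expG (a i) (t i)) * (fderiv ℝ (fun t => mat (F t)) t y * mat (F t)⁻¹) *
            mat (expG (a i) (t i))⁻¹ := by
        rw [hd, mul_inv_rev, mat_mul, add_mul, smul_mul_assoc]
        congr 1
        · rw [mul_assoc, mul_assoc, ← mul_assoc (mat (F t)), mat_mul_inv, one_mul, mat_mul_inv,
            mul_one]
        · simp only [mul_assoc]
      rw [h3]
      exact add_mem (Submodule.smul_mem _ _ (Submodule.subset_span (a i).2))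
        (conj_mem_span_lieAlg _ (hFW t y))
    · rw [hd, hFd, Finset.sum_insert hi]
      simp [expG_zero, hF0]

/-- A function that is `C¹` near a point agrees near that point with a globally `C¹` function. -/
theorem exists_contDiff_eventuallyEq {E E' : Type*} [NormedAddCommGroup E] [NormedSpace ℝ E]
    [FiniteDimensional ℝ E] [NormedAddCommGroup E'] [NormedSpace ℝ E'] {f : E → E'} {x : E}
    (hf : ContDiffAt ℝ 1 f x) : ∃ f' : E → E', ContDiff ℝ 1 f' ∧ f' =ᶠ[𝓝 x] f := by
  have h1 : ∀ᶠ y in 𝓝 x, ContDiffAt ℝ 1 f y := hf.eventually (by simp)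
  obtain ⟨r, hr, hball⟩ := Metric.eventually_nhds_iff_ball.1 h1
  let b : ContDiffBump x := ⟨r / 4, r / 2, by positivity, by linarith⟩
  refine ⟨fun y => b y • f y, contDiff_iff_contDiffAt.2 fun y => ?_, ?_⟩
  · by_cases hy : y ∈ tsupport fun y => b y • f y
    swap
    · exact contDiffAt_const.congr_of_eventuallyEq (notMem_tsupport_iff_eventuallyEq.1 hy)
    have h2 : y ∈ tsupport b := closure_mono (Function.support_smul_subset_left b f) hy
    rw [b.tsupport_eq] at h2
    exact b.contDiff.contDiffAt.smul
      (hball y (Metric.closedBall_subset_ball (half_lt_self hr) h2))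
  · filter_upwards [b.eventuallyEq_one] with y hy
    rw [hy]; simp

/-- For a suitable smooth family `F` in `G`, the directions `DF(t) y F(t)⁻¹` exhaust the span of the
Lie algebra for `t` near `0`, and `y` can be chosen linearly in the prescribed direction, as a `C¹`
function of `t`. -/
theorem exists_coordinates (G : Subgroup (GL (Fin n) ℝ)) :
    ∃ (d : ℕ) (F : (Fin d → ℝ) → G)
      (R : (Fin d → ℝ) → Matrix (Fin n) (Fin n) ℝ →ₗ[ℝ] (Fin d → ℝ)),
      ContDiff ℝ ∞ (fun t => mat (F t)) ∧ ContDiff ℝ ∞ (fun t => mat (F t)⁻¹) ∧ F 0 = 1 ∧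
      (∀ Z : (Fin d → ℝ) → Matrix (Fin n) (Fin n) ℝ, ContDiff ℝ 1 Z →
        ContDiff ℝ 1 fun t => R t (Z t)) ∧
      ∀ᶠ t in 𝓝 0, ∀ Z ∈ Submodule.span ℝ (lieAlg G),
        fderiv ℝ (fun t => mat (F t)) t (R t Z) * mat (F t)⁻¹ = Z := by
  obtain ⟨b, hbs, hspan, hli⟩ := exists_linearIndependent ℝ (lieAlg G)
  have : Finite b := hli.finite
  obtain ⟨d, ⟨e⟩⟩ := Finite.exists_equiv_fin b
  let a : Fin d → lieAlg G := fun i => ⟨e.symm i, hbs (e.symm i).2⟩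
  have hali : LinearIndependent ℝ fun i => (a i : Matrix (Fin n) (Fin n) ℝ) :=
    hli.comp e.symm e.symm.injective
  have haspan : Submodule.span ℝ (Set.range fun i => (a i : Matrix (Fin n) (Fin n) ℝ)) =
      Submodule.span ℝ (lieAlg G) := by
    rw [← hspan]
    congr 1
    ext Z
    constructor
    · rintro ⟨i, rfl⟩
      exact (e.symm i).2
    · intro hZ
      exact ⟨e ⟨Z, hZ⟩, by simp [a]⟩
  obtain ⟨F, hF, hF', hF0, hFW, hFd⟩ := exists_prod_exp a Finset.univ
  let L : (Fin d → ℝ) →ₗ[ℝ] Matrix (Fin n) (Fin n) ℝ :=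
    Fintype.linearCombination ℝ fun i => (a i : Matrix (Fin n) (Fin n) ℝ)
  have hL : ∀ y, L y = ∑ i, y i • (a i : Matrix (Fin n) (Fin n) ℝ) := fun y => rfl
  have hLinj : LinearMap.ker L = ⊥ := LinearMap.ker_eq_bot.2
    (linearIndependent_iff_injective_fintypeLinearCombination.1 hali)
  obtain ⟨C₀, hC₀⟩ := L.exists_leftInverse_of_injective hLinj
  let C : Matrix (Fin n) (Fin n) ℝ →L[ℝ] (Fin d → ℝ) := C₀.toContinuousLinearMap
  have hCL : ∀ y, C (L y) = y := fun y => LinearMap.congr_fun hC₀ y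
  have hLC : ∀ Z ∈ Submodule.span ℝ (lieAlg G), L (C Z) = Z := by
    intro Z hZ
    rw [← haspan, ← Fintype.range_linearCombination] at hZ
    obtain ⟨y, rfl⟩ := hZ
    exact congrArg L (hCL y)
  let T : (Fin d → ℝ) → (Fin d → ℝ) →L[ℝ] (Fin d → ℝ) := fun t => LinearMap.toContinuousLinearMap
    (C.toLinearMap ∘ₗ LinearMap.mulRight ℝ (mat (F t)⁻¹) ∘ₗ
      (fderiv ℝ (fun t => mat (F t)) t).toLinearMap)
  have hTy : ∀ t y, T t y = C (fderiv ℝ (fun t => mat (F t)) t y * mat (F t)⁻¹) := fun t y => rfl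
  have hT : ContDiff ℝ 1 T := by
    refine contDiff_clm_apply_iff.2 fun y => ?_
    simp only [hTy]
    refine C.contDiff.comp (ContDiff.mul ?_ (hF'.of_le (mod_cast le_top)))
    exact ContDiff.fderiv_apply (f := fun _ t => mat (F t)) (m := ∞) (hF.comp contDiff_snd)
      contDiff_id contDiff_const
      (by
        rw [one_add_one_eq_two]
        exact WithTop.coe_le_coe.2 (le_top : (2 : ℕ∞) ≤ ⊤))
  have hT0 : T 0 = 1 := by
    ext1 y
    rw [hTy, one_apply_eq_self, hFd, hF0, inv_one, mat_one, mul_one, ← hL, hCL]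
  have hunit : ∀ᶠ t in 𝓝 0, IsUnit (T t) := by
    have h1 : ∀ᶠ A in 𝓝 (T 0), IsUnit A := by
      rw [hT0]; exact Units.nhds 1
    exact hT.continuous.continuousAt h1
  have hT' : ContDiffAt ℝ 1 (fun t => Ring.inverse (T t)) 0 := by
    have h1 : ContDiffAt ℝ 1 Ring.inverse (T 0) := by
      rw [hT0]
      exact contDiffAt_ringInverse ℝ (1 : ((Fin d → ℝ) →L[ℝ] (Fin d → ℝ))ˣ)
    exact h1.comp (0 : Fin d → ℝ) hT.contDiffAt
  obtain ⟨P, hP, hPe⟩ := exists_contDiff_eventuallyEq hT'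
  refine ⟨d, F, fun t => (P t).toLinearMap ∘ₗ C₀, hF, hF', hF0,
    fun Z hZ => hP.clm_apply (C.contDiff.comp hZ), ?_⟩
  filter_upwards [hunit, hPe] with t ht htP Z hZ
  rw [← sub_eq_zero]
  set D := fderiv ℝ (fun t => mat (F t)) t (((P t).toLinearMap ∘ₗ C₀) Z) * mat (F t)⁻¹ - Z with hD
  have hDW : D ∈ Submodule.span ℝ (lieAlg G) := sub_mem (hFW t _) hZ
  -- `D` lies in the span of the Lie algebra, on which the coordinate map `C` is injective
  have hCD : C D = 0 := by
    have h2 : T t (P t (C Z)) = C Z := by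
      rw [htP]
      exact DFunLike.congr_fun (Ring.mul_inverse_cancel (T t) ht) (C Z)
    rw [hD, map_sub]
    exact sub_eq_zero.2 h2
  rw [← hLC D hDW, hCD, map_zero]

/-! ### The kernels of the mollified operators -/

/-- The divergence of a vector field on `ℝᵈ`. -/
def divergence (V : (Fin d → ℝ) → Fin d → ℝ) (u : Fin d → ℝ) : ℝ :=
  ∑ i, fderiv ℝ (fun u => V u i) u (Pi.single i 1)

theorem continuous_divergence {V : (Fin d → ℝ) → Fin d → ℝ} (hV : ContDiff ℝ 1 V) :
    Continuous (divergence V) := by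
  unfold divergence
  refine continuous_finsetSum _ fun i _ => ?_
  exact ((contDiff_pi.1 hV i).continuous_fderiv one_ne_zero).clm_apply continuous_const

theorem divergence_eq_zero {V : (Fin d → ℝ) → Fin d → ℝ} {u : Fin d → ℝ} (hu : u ∉ tsupport V) :
    divergence V u = 0 := by
  refine Finset.sum_eq_zero fun i _ => ?_
  have h1 : (fun u => V u i) =ᶠ[𝓝 u] fun _ => 0 :=
    (notMem_tsupport_iff_eventuallyEq.1 hu).mono fun y hy => by
      change V y i = 0
      rw [hy]; rfl
  rw [h1.fderiv_eq]
  simp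

/-- Integration by parts on `ℝᵈ` against a compactly supported vector field. -/
theorem integral_divergence_smul {V : (Fin d → ℝ) → Fin d → ℝ} (hV : ContDiff ℝ 1 V)
    (hVc : HasCompactSupport V) {f : (Fin d → ℝ) → ℂ} (hf : ContDiff ℝ 1 f) :
    ∫ u, divergence V u • f u = -∫ u, fderiv ℝ f u (V u) := by
  have hVi : ∀ i, ContDiff ℝ 1 fun u => V u i := contDiff_pi.1 hV
  have hVic : ∀ i, HasCompactSupport fun u => V u i := fun i =>
    hVc.comp_left (g := fun y : Fin d → ℝ => y i) rfl
  have hfc : ∀ y, Continuous fun u => fderiv ℝ f u y := fun y =>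
    (hf.continuous_fderiv one_ne_zero).clm_apply continuous_const
  have h1 : ∀ i, Integrable fun u => fderiv ℝ (fun u => V u i) u (Pi.single i 1) • f u := fun i =>
    (((hVi i).continuous_fderiv one_ne_zero).clm_apply continuous_const |>.smul
      hf.continuous).integrable_of_hasCompactSupport (((hVic i).fderiv_apply ℝ _).smul_right)
  have h2 : ∀ i, Integrable fun u => V u i • fderiv ℝ f u (Pi.single i 1) := fun i =>
    ((hVi i).continuous.smul (hfc _)).integrable_of_hasCompactSupport (hVic i).smul_right
  have h3 : ∀ i, Integrable fun u => V u i • f u := fun i =>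
    ((hVi i).continuous.smul hf.continuous).integrable_of_hasCompactSupport (hVic i).smul_right
  have h4 : ∀ u, fderiv ℝ f u (V u) = ∑ i, V u i • fderiv ℝ f u (Pi.single i 1) := by
    intro u
    conv_lhs => rw [pi_eq_sum_univ' (V u)]
    rw [map_sum]
    refine Finset.sum_congr rfl fun i _ => ?_
    rw [map_smul]
  simp only [divergence, Finset.sum_smul, h4]
  rw [integral_finsetSum _ fun i _ => h1 i, integral_finsetSum _ fun i _ => h2 i,
    ← Finset.sum_neg_distrib]
  refine Finset.sum_congr rfl fun i _ => ?_
  rw [integral_smul_fderiv_eq_neg_fderiv_smul_of_integrable (h1 i) (h2 i) (h3 i)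
    (fun u _ => (hVi i).differentiable one_ne_zero u)
    (fun u _ => hf.differentiable one_ne_zero u), neg_neg]

/-- The kernel obtained by moving the first-order operator `v` off the scaled function
`u ↦ f (ε u)` onto the weight `ρ`. -/
def kernel (ρ : (Fin d → ℝ) → ℝ) (v : (Fin d → ℝ) → Fin d → ℝ) (ε : ℝ) (u : Fin d → ℝ) : ℝ :=
  -(ε⁻¹ * divergence (fun u => ρ u • v (ε • u)) u)

section kernel

variable {ρ : (Fin d → ℝ) → ℝ} {v : (Fin d → ℝ) → Fin d → ℝ}

theorem contDiff_smul_comp_smul (hρ : ContDiff ℝ 1 ρ) (hv : ContDiff ℝ 1 v) (ε : ℝ) :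
    ContDiff ℝ 1 fun u => ρ u • v (ε • u) :=
  hρ.smul (hv.comp (contDiff_const_smul ε))

theorem continuous_kernel (hρ : ContDiff ℝ 1 ρ) (hv : ContDiff ℝ 1 v) (ε : ℝ) :
    Continuous (kernel ρ v ε) :=
  (continuous_const.mul (continuous_divergence (contDiff_smul_comp_smul hρ hv ε))).neg

theorem kernel_eq_zero {ε : ℝ} {u : Fin d → ℝ} (hu : u ∉ tsupport ρ) : kernel ρ v ε u = 0 := by
  rw [kernel, divergence_eq_zero, mul_zero, neg_zero]
  exact fun h => hu (closure_mono (Function.support_smul_subset_left ρ fun u => v (ε • u)) h)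

theorem hasCompactSupport_kernel (hρc : HasCompactSupport ρ) (ε : ℝ) :
    HasCompactSupport (kernel ρ v ε) :=
  HasCompactSupport.intro hρc fun _ hu => kernel_eq_zero hu

theorem integral_kernel_smul (hρ : ContDiff ℝ 1 ρ) (hρc : HasCompactSupport ρ)
    (hv : ContDiff ℝ 1 v) {ε : ℝ} (hε : ε ≠ 0) {f : (Fin d → ℝ) → ℂ} (hf : ContDiff ℝ 1 f) :
    ∫ u, kernel ρ v ε u • f (ε • u) = ∫ u, ρ u • fderiv ℝ f (ε • u) (v (ε • u)) := by
  have h1 := integral_divergence_smul (contDiff_smul_comp_smul hρ hv ε) hρc.smul_right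
    (hf.comp (contDiff_const_smul ε))
  have h2 : ∀ u, fderiv ℝ (f ∘ fun u => ε • u) u (ρ u • v (ε • u)) =
      ε • (ρ u • fderiv ℝ f (ε • u) (v (ε • u))) := by
    intro u
    have h3 := (hf.differentiable one_ne_zero (ε • u)).hasFDerivAt.comp u
      ((hasFDerivAt_id u).const_smul ε)
    have h4 := DFunLike.congr_fun h3.fderiv (ρ u • v (ε • u))
    refine h4.trans ?_
    simp [mul_left_comm]
  simp only [h2, integral_smul, Function.comp_apply] at h1
  simp only [kernel, neg_smul, mul_smul, integral_neg, integral_smul, h1]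
  rw [smul_neg, neg_neg, smul_smul, inv_mul_cancel₀ hε, one_smul]

theorem integral_kernel (hρ : ContDiff ℝ 1 ρ) (hρc : HasCompactSupport ρ)
    (hv : ContDiff ℝ 1 v) {ε : ℝ} (hε : ε ≠ 0) : ∫ u, kernel ρ v ε u = 0 := by
  have h := integral_kernel_smul hρ hρc hv hε (f := fun _ => 1) contDiff_const
  simp only [fderiv_fun_const, Pi.zero_apply, zero_apply, smul_zero, integral_zero] at h
  rw [integral_smul_const] at h
  simpa using h

theorem kernel_sub {w : (Fin d → ℝ) → Fin d → ℝ} (hρ : ContDiff ℝ 1 ρ) (hv : ContDiff ℝ 1 v)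
    (hw : ContDiff ℝ 1 w) (ε : ℝ) (u : Fin d → ℝ) :
    kernel ρ (fun t => v t - w t) ε u = kernel ρ v ε u - kernel ρ w ε u := by
  have h : divergence (fun u => ρ u • (v (ε • u) - w (ε • u))) u =
      divergence (fun u => ρ u • v (ε • u)) u - divergence (fun u => ρ u • w (ε • u)) u := by
    rw [divergence, divergence, divergence, ← Finset.sum_sub_distrib]
    refine Finset.sum_congr rfl fun i _ => ?_
    rw [← sub_apply, ← fderiv_fun_sub]
    · simp only [Pi.smul_apply, Pi.sub_apply, smul_sub]
    · exact (contDiff_pi.1 (contDiff_smul_comp_smul hρ hv ε) i).differentiable one_ne_zero u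
    · exact (contDiff_pi.1 (contDiff_smul_comp_smul hρ hw ε) i).differentiable one_ne_zero u
  rw [kernel, h, kernel, kernel]
  ring

/-- If the vector field vanishes at the origin, then the kernels stay bounded as `ε → 0`. -/
theorem exists_abs_kernel_le (hρ : ContDiff ℝ 1 ρ) (hρs : tsupport ρ ⊆ Metric.closedBall 0 1)
    (hv : ContDiff ℝ 1 v) (hv0 : v 0 = 0) :
    ∃ C, ∀ ε, 0 < ε → ε ≤ 1 → ∀ u, |kernel ρ v ε u| ≤ C := by
  have hcpt := isCompact_closedBall (0 : Fin d → ℝ) 1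
  obtain ⟨L, hL⟩ := hcpt.exists_bound_of_continuousOn
    (hv.continuous_fderiv one_ne_zero).continuousOn
  obtain ⟨P, hP⟩ := hcpt.exists_bound_of_continuousOn hρ.continuous.continuousOn
  obtain ⟨P', hP'⟩ := hcpt.exists_bound_of_continuousOn
    (hρ.continuous_fderiv one_ne_zero).continuousOn
  have h00 : (0 : Fin d → ℝ) ∈ Metric.closedBall (0 : Fin d → ℝ) 1 :=
    Metric.mem_closedBall_self zero_le_one
  have hL0 : 0 ≤ L := (norm_nonneg _).trans (hL 0 h00)
  have hP0 : 0 ≤ P := (norm_nonneg _).trans (hP 0 h00)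
  have hP'0 : 0 ≤ P' := (norm_nonneg _).trans (hP' 0 h00)
  refine ⟨d * (P * L + L * P'), fun ε hε hε1 u => ?_⟩
  by_cases hu : u ∈ tsupport ρ
  swap
  · rw [kernel_eq_zero hu, abs_zero]; positivity
  have hu1 := hρs hu
  have hun : ‖u‖ ≤ 1 := by simpa using hu1
  have hεn : ‖ε • u‖ ≤ ε := by
    rw [norm_smul, Real.norm_of_nonneg hε.le]
    exact mul_le_of_le_one_right hε.le hun
  have hεu : ε • u ∈ Metric.closedBall (0 : Fin d → ℝ) 1 := by
    simpa using hεn.trans hε1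
  have hvb : ‖v (ε • u)‖ ≤ L * ε := by
    have := (convex_closedBall (0 : Fin d → ℝ) 1).norm_image_sub_le_of_norm_fderiv_le
      (fun x _ => hv.differentiable one_ne_zero x) hL h00 hεu
    rw [hv0, sub_zero, sub_zero] at this
    exact this.trans (by gcongr)
  have hterm : ∀ i, |fderiv ℝ (fun u => (ρ u • v (ε • u)) i) u (Pi.single i 1)| ≤
      ε * (P * L + L * P') := by
    intro i
    have hs : ‖(Pi.single i 1 : Fin d → ℝ)‖ ≤ 1 := by simp [Pi.norm_single]
    have h1 : HasFDerivAt (fun u => v (ε • u) i)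
        (ε • (ContinuousLinearMap.proj (R := ℝ) (φ := fun _ : Fin d => ℝ) i).comp
          (fderiv ℝ v (ε • u))) u := by
      have h2 := (hv.differentiable one_ne_zero (ε • u)).hasFDerivAt.comp u
        ((hasFDerivAt_id u).const_smul ε)
      have h3 := (ContinuousLinearMap.proj (R := ℝ) (φ := fun _ : Fin d => ℝ) i).hasFDerivAt.comp u
        h2
      refine h3.congr_fderiv ?_
      ext1 y
      simp
    have h4 := (hρ.differentiable one_ne_zero u).hasFDerivAt.mul h1
    have h5 : fderiv ℝ (fun u => (ρ u • v (ε • u)) i) u (Pi.single i 1) =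
        ρ u * (ε * fderiv ℝ v (ε • u) (Pi.single i 1) i) +
          v (ε • u) i * fderiv ℝ ρ u (Pi.single i 1) :=
      DFunLike.congr_fun h4.fderiv (Pi.single i 1)
    have h6 : |fderiv ℝ v (ε • u) (Pi.single i 1) i| ≤ L := by
      refine (norm_le_pi_norm (fderiv ℝ v (ε • u) (Pi.single i 1)) i).trans ?_
      refine (ContinuousLinearMap.le_opNorm _ _).trans ?_
      exact (mul_le_of_le_one_right (norm_nonneg _) hs).trans (hL _ hεu)
    have h7 : |fderiv ℝ ρ u (Pi.single i 1)| ≤ P' :=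
      (ContinuousLinearMap.le_opNorm _ _).trans
        ((mul_le_of_le_one_right (norm_nonneg _) hs).trans (hP' _ hu1))
    have h8 : |v (ε • u) i| ≤ L * ε := (norm_le_pi_norm (v (ε • u)) i).trans hvb
    rw [h5]
    refine (abs_add_le _ _).trans ?_
    rw [abs_mul, abs_mul, abs_mul, abs_of_pos hε]
    calc _ ≤ P * (ε * L) + L * ε * P' := by
          gcongr
          exact hP u hu1
      _ = _ := by ring
  rw [kernel, abs_neg, abs_mul, abs_of_pos (inv_pos.2 hε), inv_mul_le_iff₀ hε]
  calc _ ≤ ∑ i, |fderiv ℝ (fun u => (ρ u • v (ε • u)) i) u (Pi.single i 1)| :=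
        Finset.abs_sum_le_sum_abs _ _
    _ ≤ ∑ _i : Fin d, ε * (P * L + L * P') := Finset.sum_le_sum fun i _ => hterm i
    _ = _ := by
      rw [Finset.sum_const, Finset.card_univ, Fintype.card_fin, nsmul_eq_mul]
      ring

end kernel

/-! ### Mollification along the group -/

theorem continuous_leftRegular_of_continuous {T : Type*} [TopologicalSpace T] (hM : IsClosed M)
    (hGM : Preserves G M) {g : T → G} (hg : Continuous fun t => mat (g t))
    (hg' : Continuous fun t => mat (g t)⁻¹) {χ : T → C₀(M, ℂ)} (hχ : Continuous χ) :
    Continuous fun t => leftRegular hGM (g t) (χ t) := by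
  rw [continuous_iff_continuousAt]
  intro t₀
  have h1 := (continuous_leftRegular hM hGM hg hg' (χ t₀)).tendsto t₀
  have h2 : Tendsto (fun t => leftRegular hGM (g t) (χ t - χ t₀)) (𝓝 t₀) (𝓝 0) := by
    refine squeeze_zero_norm (fun t => norm_leftRegular_le hGM _ _) ?_
    have h3 : Continuous fun t => ‖χ t - χ t₀‖ := (hχ.sub continuous_const).norm
    simpa using h3.tendsto t₀
  have h4 := h2.add h1
  rw [zero_add] at h4
  refine h4.congr fun t => ?_
  rw [map_sub, sub_add_cancel]

theorem continuous_leftRegular_gpDer {T : Type*} [TopologicalSpace T] (hM : IsClosed M)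
    (hGM : Preserves G M) {g : T → G} (hg : Continuous fun t => mat (g t))
    (hg' : Continuous fun t => mat (g t)⁻¹) {A : T → Matrix (Fin n) (Fin n) ℝ} (hA : Continuous A)
    (p : MvPolynomial (Fin n) ℂ) :
    Continuous fun t => leftRegular hGM (g t) (gp hM (gaussDer (A t) p)) :=
  continuous_leftRegular_of_continuous hM hGM hg hg'
    ((gpDer hM p).continuous_of_finiteDimensional.comp hA)

section family

variable {F : (Fin d → ℝ) → G}

theorem contDiff_gaussFun_mulVec (hF' : ContDiff ℝ ∞ fun t => mat (F t)⁻¹)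
    (p : MvPolynomial (Fin n) ℂ) (m : Fin n → ℝ) :
    ContDiff ℝ ∞ fun t => gaussFun p ((mat (F t)⁻¹).mulVec m) := by
  let ℓ : Matrix (Fin n) (Fin n) ℝ →ₗ[ℝ] (Fin n → ℝ) :=
    { toFun := fun A => A.mulVec m
      map_add' := fun A B => Matrix.add_mulVec A B m
      map_smul' := fun c A => Matrix.smul_mulVec c A m }
  exact (contDiff_gaussFun p).comp (ℓ.toContinuousLinearMap.contDiff.comp hF')

/-- The derivative of `t ↦ π(F(t)) (p e^{-r²})` in a direction in which the right logarithmic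
derivative of `F` is `Z`. -/
theorem fderiv_gaussFun_mulVec (hF : ContDiff ℝ ∞ fun t => mat (F t))
    (hF' : ContDiff ℝ ∞ fun t => mat (F t)⁻¹) (p : MvPolynomial (Fin n) ℂ) (m : Fin n → ℝ)
    {t y : Fin d → ℝ} {Z : Matrix (Fin n) (Fin n) ℝ}
    (hZ : fderiv ℝ (fun t => mat (F t)) t y * mat (F t)⁻¹ = Z) :
    fderiv ℝ (fun t => gaussFun p ((mat (F t)⁻¹).mulVec m)) t y =
      gaussFun (gaussDer (mat (F t)⁻¹ * Z * mat (F t)) p) ((mat (F t)⁻¹).mulVec m) := by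
  have h1 := (hF.differentiable (by simp) t).hasFDerivAt
  have h2 := (hF'.differentiable (by simp) t).hasFDerivAt
  have h3 : fderiv ℝ (fun t => mat (F t)⁻¹) t y * mat (F t) +
      mat (F t)⁻¹ * fderiv ℝ (fun t => mat (F t)) t y = 0 := by
    have h4 := DFunLike.congr_fun (h2.mul' h1).fderiv y
    have h5 : ((fun t => mat (F t)⁻¹) * fun t => mat (F t)) = fun _ => 1 := by
      funext t; exact mat_inv_mul (F t)
    rw [h5, fderiv_fun_const] at h4
    exact ((add_comm _ _).trans h4.symm)
  have h6 : fderiv ℝ (fun t => mat (F t)⁻¹) t y = -(mat (F t)⁻¹ * Z * mat (F t)) * mat (F t)⁻¹ := by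
    have h7 := eq_neg_of_add_eq_zero_left h3
    calc _ = fderiv ℝ (fun t => mat (F t)⁻¹) t y * mat (F t) * mat (F t)⁻¹ := by
          rw [mul_assoc, mat_mul_inv, mul_one]
      _ = _ := by
          rw [h7, ← hZ]
          simp only [mul_assoc, mat_inv_mul, mul_one]
  let ℓ : Matrix (Fin n) (Fin n) ℝ →ₗ[ℝ] (Fin n → ℝ) :=
    { toFun := fun A => A.mulVec m
      map_add' := fun A B => Matrix.add_mulVec A B m
      map_smul' := fun c A => Matrix.smul_mulVec c A m }
  have h8 := ℓ.toContinuousLinearMap.hasFDerivAt.comp t h2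
  have h9 := (((contDiff_gaussFun p).differentiable (by simp)
    ((mat (F t)⁻¹).mulVec m)).hasFDerivAt.comp t h8).fderiv
  refine (DFunLike.congr_fun h9 y).trans ?_
  change fderiv ℝ (gaussFun p) _ ((fderiv ℝ (fun t => mat (F t)⁻¹) t y).mulVec m) = _
  rw [h6, ← fderiv_gaussFun, ← Matrix.mulVec_mulVec, Matrix.neg_mulVec]

variable (hM : IsClosed M) (hGM : Preserves G M) (hF : ContDiff ℝ ∞ fun t => mat (F t))
  (hF' : ContDiff ℝ ∞ fun t => mat (F t)⁻¹)
include hM hF hF'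

theorem integrable_smul_leftRegular {k : (Fin d → ℝ) → ℝ} (hk : Continuous k)
    (hkc : HasCompactSupport k) (ε : ℝ) (φ : C₀(M, ℂ)) :
    Integrable fun u => k u • leftRegular hGM (F (ε • u)) φ :=
  (hk.smul (continuous_leftRegular hM hGM (hF.continuous.comp (continuous_const_smul ε))
    (hF'.continuous.comp (continuous_const_smul ε)) φ)).integrable_of_hasCompactSupport
      hkc.smul_right

theorem continuous_wavg_smul {k : (Fin d → ℝ) → ℝ} (hk : Continuous k)
    (hkc : HasCompactSupport k) (ε : ℝ) :
    Continuous (wavg hGM volume k fun u => F (ε • u)) :=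
  continuous_wavg (hk.integrable_of_hasCompactSupport hkc)
    (integrable_smul_leftRegular hM hGM hF hF' hk hkc ε)

theorem integrable_smul_leftRegular_gp {ρ : (Fin d → ℝ) → ℝ} (hρ : Continuous ρ)
    (hρc : HasCompactSupport ρ) {Z : (Fin d → ℝ) → Matrix (Fin n) (Fin n) ℝ} (hZ : Continuous Z)
    (ε : ℝ) (p : MvPolynomial (Fin n) ℂ) :
    Integrable fun u => ρ u • leftRegular hGM (F (ε • u))
      (gp hM (gaussDer (mat (F (ε • u))⁻¹ * Z (ε • u) * mat (F (ε • u))) p)) := by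
  have h1 : Continuous fun u : Fin d → ℝ => mat (F (ε • u)) :=
    hF.continuous.comp (continuous_const_smul ε)
  have h2 : Continuous fun u : Fin d → ℝ => mat (F (ε • u))⁻¹ :=
    hF'.continuous.comp (continuous_const_smul ε)
  have h3 : Continuous fun u : Fin d → ℝ => Z (ε • u) := hZ.comp (continuous_const_smul ε)
  exact (hρ.smul (continuous_leftRegular_gpDer hM hGM h1 h2 ((h2.mul h3).mul h1)
    p)).integrable_of_hasCompactSupport hρc.smul_right

/-- Integration by parts: if `v(t)` is the direction in which the right logarithmic derivative of
`F` is `Z(t)`, then the average of the derivatives of `p e^{-r²}` along the translates of `Z` is an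
average of translates of `p e^{-r²}` itself. -/
theorem wavg_kernel_gp {ρ : (Fin d → ℝ) → ℝ} (hρ : ContDiff ℝ 1 ρ) (hρc : HasCompactSupport ρ)
    {Z : (Fin d → ℝ) → Matrix (Fin n) (Fin n) ℝ} (hZ : Continuous Z)
    {v : (Fin d → ℝ) → Fin d → ℝ} (hv : ContDiff ℝ 1 v) {ε : ℝ} (hε : ε ≠ 0)
    (hvZ : ∀ u ∈ tsupport ρ, fderiv ℝ (fun t => mat (F t)) (ε • u) (v (ε • u)) *
      mat (F (ε • u))⁻¹ = Z (ε • u)) (p : MvPolynomial (Fin n) ℂ) :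
    wavg hGM volume (kernel ρ v ε) (fun u => F (ε • u)) (gp hM p) =
      ∫ u, ρ u • leftRegular hGM (F (ε • u))
        (gp hM (gaussDer (mat (F (ε • u))⁻¹ * Z (ε • u) * mat (F (ε • u))) p)) := by
  ext m
  rw [wavg_apply (integrable_smul_leftRegular hM hGM hF hF' (continuous_kernel hρ hv ε)
    (hasCompactSupport_kernel hρc ε) ε _)]
  have h1 := (evalCLM m).integral_comp_comm
    (integrable_smul_leftRegular_gp hM hGM hF hF' hρ.continuous hρc hZ ε p)
  simp only [evalCLM_apply] at h1
  rw [← h1]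
  refine (integral_kernel_smul hρ hρc hv hε
    ((contDiff_gaussFun_mulVec hF' p m).of_le (mod_cast le_top))).trans ?_
  refine integral_congr_ae (Eventually.of_forall fun u => ?_)
  change _ = ρ u • leftRegular hGM (F (ε • u)) _ m
  rw [leftRegular_gp]
  by_cases hu : u ∈ tsupport ρ
  · rw [← fderiv_gaussFun_mulVec hF hF' p m (hvZ u hu)]
  · simp only [image_eq_zero_of_notMem_tsupport hu, zero_smul]

/-- The mollification of `φ` and its formal derivatives along the `X i`, written as averages of
translates of `φ`, are simultaneous limits of polynomials times the Gaussian and of their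
derivatives. -/
theorem wavg_mem_polyGraph (X : ι → lieAlg G) {ρ : (Fin d → ℝ) → ℝ} (hρ : ContDiff ℝ 1 ρ)
    (hρc : HasCompactSupport ρ) {v : ι → (Fin d → ℝ) → Fin d → ℝ} (hv : ∀ i, ContDiff ℝ 1 (v i))
    {ε : ℝ} (hε : ε ≠ 0) [Fintype ι]
    (hnear : ∀ u ∈ tsupport ρ, ∀ x, |rsq x - rsq ((mat (F (ε • u))⁻¹).mulVec x)| ≤ rsq x / 4)
    (hvX : ∀ i, ∀ u ∈ tsupport ρ, fderiv ℝ (fun t => mat (F t)) (ε • u) (v i (ε • u)) *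
      mat (F (ε • u))⁻¹ = X i) (φ : C₀(M, ℂ)) :
    (wavg hGM volume ρ (fun u => F (ε • u)) φ,
      fun i => wavg hGM volume (kernel ρ (v i) ε) (fun u => F (ε • u)) φ) ∈
      (polyGraph hM fun i => (X i : Matrix (Fin n) (Fin n) ℝ)).topologicalClosure := by
  set K := (polyGraph hM fun i => (X i : Matrix (Fin n) (Fin n) ℝ)).topologicalClosure with hKd
  have hK : IsClosed (K : Set (C₀(M, ℂ) × (ι → C₀(M, ℂ)))) :=
    Submodule.isClosed_topologicalClosure _
  have hKr : IsClosed (K.restrictScalars ℝ : Set (C₀(M, ℂ) × (ι → C₀(M, ℂ)))) := hK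
  have hclosed : IsClosed {φ : C₀(M, ℂ) | (wavg hGM volume ρ (fun u => F (ε • u)) φ,
      fun i => wavg hGM volume (kernel ρ (v i) ε) (fun u => F (ε • u)) φ) ∈ K} := by
    refine hK.preimage ((continuous_wavg_smul hM hGM hF hF' hρ.continuous hρc ε).prodMk
      (continuous_pi fun i => ?_))
    exact continuous_wavg_smul hM hGM hF hF' (continuous_kernel hρ (hv i) ε)
      (hasCompactSupport_kernel hρc ε) ε
  refine hclosed.closure_subset_iff.2 ?_ (dense_gaussPoly hM φ)
  intro φ hφ
  obtain ⟨p, rfl⟩ := (mem_gaussPoly_iff hM).1 hφ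
  have h1 : Continuous fun u : Fin d → ℝ => mat (F (ε • u)) :=
    hF.continuous.comp (continuous_const_smul ε)
  have h2 : Continuous fun u : Fin d → ℝ => mat (F (ε • u))⁻¹ :=
    hF'.continuous.comp (continuous_const_smul ε)
  let z : (Fin d → ℝ) → C₀(M, ℂ) × (ι → C₀(M, ℂ)) := fun u =>
    (leftRegular hGM (F (ε • u)) (gp hM p), fun i => leftRegular hGM (F (ε • u))
      (gp hM (gaussDer (mat (F (ε • u))⁻¹ * X i * mat (F (ε • u))) p)))
  have hz : Continuous z := (continuous_leftRegular hM hGM h1 h2 _).prodMk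
    (continuous_pi fun i => continuous_leftRegular_gpDer hM hGM h1 h2
      ((h2.mul continuous_const).mul h1) p)
  have hi : Integrable fun u => ρ u • z u :=
    (hρ.continuous.smul hz).integrable_of_hasCompactSupport hρc.smul_right
  have hzK : ∀ u ∈ tsupport ρ, z u ∈ K.restrictScalars ℝ := fun u hu =>
    leftRegular_gp_mem hM hGM X (F (ε • u)) (hnear u hu) p
  have hm := integral_mem_of_isClosed hKr hi (Eventually.of_forall fun u => by
    by_cases hu : u ∈ tsupport ρ
    · exact (K.restrictScalars ℝ).smul_mem (ρ u) (hzK u hu)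
    · rw [image_eq_zero_of_notMem_tsupport hu, zero_smul]
      exact (K.restrictScalars ℝ).zero_mem)
  refine (congrArg (· ∈ K) ?_).mpr hm
  refine Prod.ext ?_ ?_
  · change _ = ContinuousLinearMap.fst ℝ _ _ _
    rw [← ContinuousLinearMap.integral_comp_comm _ hi]
    rfl
  · funext i
    change _ = ((ContinuousLinearMap.proj (R := ℝ) (φ := fun _ : ι => C₀(M, ℂ)) i).comp
      (ContinuousLinearMap.snd ℝ _ _)) _
    rw [← ContinuousLinearMap.integral_comp_comm _ hi]
    exact wavg_kernel_gp hM hGM hF hF' hρ hρc continuous_const (hv i) hε (hvX i) p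

/-- The mollification of `dπ(X) φ` is an average of translates of `φ`, for every `φ` in the domain
of `dπ(X)`. -/
theorem IsGen.wavg_eq {X : lieAlg G} {φ ψ : C₀(M, ℂ)} (hφ : IsGen hGM X φ ψ)
    {ρ : (Fin d → ℝ) → ℝ} (hρ : ContDiff ℝ 1 ρ)
    (hρc : HasCompactSupport ρ) {w : (Fin d → ℝ) → Fin d → ℝ} (hw : ContDiff ℝ 1 w)
    {ε : ℝ} (hε : ε ≠ 0)
    (hwX : ∀ u ∈ tsupport ρ, fderiv ℝ (fun t => mat (F t)) (ε • u) (w (ε • u)) *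
      mat (F (ε • u))⁻¹ = mat (F (ε • u)) * X * mat (F (ε • u))⁻¹) :
    wavg hGM volume ρ (fun u => F (ε • u)) ψ =
      wavg hGM volume (kernel ρ w ε) (fun u => F (ε • u)) φ := by
  have hclosed : IsClosed {z : C₀(M, ℂ) × (Unit → C₀(M, ℂ)) |
      wavg hGM volume ρ (fun u => F (ε • u)) (z.2 ()) =
      wavg hGM volume (kernel ρ w ε) (fun u => F (ε • u)) z.1} := by
    refine isClosed_eq ?_ ?_
    · exact (continuous_wavg_smul hM hGM hF hF' hρ.continuous hρc ε).comp
        ((continuous_apply ()).comp continuous_snd)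
    · exact (continuous_wavg_smul hM hGM hF hF' (continuous_kernel hρ hw ε)
        (hasCompactSupport_kernel hρc ε) ε).comp continuous_fst
  refine hclosed.closure_subset_iff.2 ?_ (hφ.mem_closure_polyGraph hM)
  intro z hz
  obtain ⟨p, rfl⟩ := (mem_polyGraph hM _ _).1 hz
  have h1 := wavg_kernel_gp hM hGM hF hF' hρ hρc
    (Z := fun t => mat (F t) * (X : Matrix (Fin n) (Fin n) ℝ) * mat (F t)⁻¹)
    ((hF.continuous.mul continuous_const).mul hF'.continuous) hw hε hwX p
  refine Eq.trans ?_ h1.symm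
  refine integral_congr_ae (Eventually.of_forall fun u => ?_)
  have h2 : mat (F (ε • u))⁻¹ * (mat (F (ε • u)) * (X : Matrix (Fin n) (Fin n) ℝ) *
      mat (F (ε • u))⁻¹) * mat (F (ε • u)) = X := by
    rw [mul_assoc, mul_assoc, mat_inv_mul, mul_one, ← mul_assoc, mat_inv_mul, one_mul]
  simp only [h2]

/-- Averages over shrinking neighbourhoods of `1 ∈ G` with bounded kernels of total mass `c`
converge to `c φ`. -/
theorem tendsto_wavg (hF0 : F 0 = 1) {k : ℝ → (Fin d → ℝ) → ℝ} {C c : ℝ}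
    (hk : ∀ ε, Continuous (k ε)) (hks : ∀ ε u, u ∉ Metric.closedBall 0 1 → k ε u = 0)
    (hkC : ∀ ε, 0 < ε → ε ≤ 1 → ∀ u, |k ε u| ≤ C)
    (hkc : ∀ ε, 0 < ε → ∫ u, k ε u = c) (φ : C₀(M, ℂ)) :
    Tendsto (fun ε => wavg hGM volume (k ε) (fun u => F (ε • u)) φ) (𝓝[>] 0) (𝓝 (c • φ)) := by
  have hcpt := isCompact_closedBall (0 : Fin d → ℝ) 1
  have hcs : ∀ ε, HasCompactSupport (k ε) := fun ε => HasCompactSupport.intro hcpt (hks ε)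
  set V := volume.real (Metric.closedBall (0 : Fin d → ℝ) 1) with hV
  rw [Metric.tendsto_nhds]
  intro η hη
  obtain ⟨η', hη', hη'η⟩ : ∃ η' > 0, |C| * η' * V < η := by
    have hV0 : 0 ≤ V := measureReal_nonneg
    refine ⟨η / (|C| * V + 1), by positivity, ?_⟩
    have : |C| * (η / (|C| * V + 1)) * V = η * ((|C| * V) / (|C| * V + 1)) := by ring
    rw [this]
    refine mul_lt_of_lt_one_right hη ?_
    rw [div_lt_one (by positivity)]
    exact lt_add_one _
  have h1 := (continuous_leftRegular hM hGM hF.continuous hF'.continuous φ).tendsto 0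
  rw [hF0, map_one] at h1
  obtain ⟨δ, hδ, hball⟩ := Metric.eventually_nhds_iff.1 (Metric.tendsto_nhds.1 h1 η' hη')
  filter_upwards [Ioo_mem_nhdsGT (lt_min hδ one_pos)] with ε hε
  have hεδ := hε.2.trans_le (min_le_left _ _)
  have hε1 := hε.2.trans_le (min_le_right _ _)
  have h2 : wavg hGM volume (k ε) (fun u => F (ε • u)) φ - c • φ =
      ∫ u, k ε u • (leftRegular hGM (F (ε • u)) φ - φ) := by
    have hc : ∫ u, k ε u • φ = c • φ :=
      (integral_smul_const (k ε) φ).trans (congrArg (· • φ) (hkc ε hε.1))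
    rw [← hc, wavg, ← integral_sub
      (integrable_smul_leftRegular hM hGM hF hF' (hk ε) (hcs ε) ε φ)
      (((hk ε).integrable_of_hasCompactSupport (hcs ε)).smul_const φ)]
    refine integral_congr_ae (Eventually.of_forall fun u => ?_)
    exact (smul_sub (k ε u) (leftRegular hGM (F (ε • u)) φ) φ).symm
  have h3 : ∫ u, k ε u • (leftRegular hGM (F (ε • u)) φ - φ) =
      ∫ u in Metric.closedBall 0 1, k ε u • (leftRegular hGM (F (ε • u)) φ - φ) := by
    refine (setIntegral_eq_integral_of_forall_compl_eq_zero fun u hu => ?_).symm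
    rw [hks ε u hu]
    exact zero_smul ℝ (leftRegular hGM (F (ε • u)) φ - φ)
  rw [dist_eq_norm, h2, h3]
  refine lt_of_le_of_lt (norm_setIntegral_le_of_norm_le_const hcpt.measure_lt_top
    fun u hu => ?_) hη'η
  have h4 : dist (ε • u) 0 < δ := by
    rw [dist_zero_right, norm_smul, Real.norm_of_nonneg hε.1.le]
    rw [mem_closedBall_zero_iff] at hu
    exact (mul_le_of_le_one_right hε.1.le hu).trans_lt hεδ
  have h5 := hball h4
  rw [dist_eq_norm] at h5
  refine (norm_smul_le (k ε u) (leftRegular hGM (F (ε • u)) φ - φ)).trans ?_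
  gcongr
  · exact (hkC ε hε.1 hε1.le u).trans (le_abs_self C)
  · exact h5.le

end family

/-- Every element of the joint graph of finitely many generators is a limit of elements given by
polynomials times the Gaussian: mollify along the group, and let the mollifier concentrate at
`1`. -/
theorem mem_closure_polyGraph_of_isGen [Fintype ι] (hM : IsClosed M) {hGM : Preserves G M}
    {X : ι → lieAlg G} {φ : C₀(M, ℂ)} {ψ : ι → C₀(M, ℂ)} (hφ : ∀ i, IsGen hGM (X i) φ (ψ i)) :
    (φ, ψ) ∈ (polyGraph hM fun i => (X i : Matrix (Fin n) (Fin n) ℝ)).topologicalClosure := by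
  obtain ⟨d, F, R, hF, hF', hF0, hR, hFR⟩ := exists_coordinates G
  let b : ContDiffBump (0 : Fin d → ℝ) := ⟨1 / 2, 1, by norm_num, by norm_num⟩
  let ρ : (Fin d → ℝ) → ℝ := b.normed volume
  have hρ : ContDiff ℝ 1 ρ := b.contDiff_normed
  have hρc : HasCompactSupport ρ := b.hasCompactSupport_normed
  have hρs : tsupport ρ = Metric.closedBall 0 1 := b.tsupport_normed_eq
  have hρ1 : ∫ u, ρ u = 1 := b.integral_normed
  let v : ι → (Fin d → ℝ) → Fin d → ℝ := fun i t => R t (X i)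
  let w : ι → (Fin d → ℝ) → Fin d → ℝ := fun i t => R t (mat (F t) * X i * mat (F t)⁻¹)
  have hv : ∀ i, ContDiff ℝ 1 (v i) := fun i => hR _ contDiff_const
  have hw : ∀ i, ContDiff ℝ 1 (w i) := fun i =>
    hR _ (((hF.of_le (mod_cast le_top)).mul contDiff_const).mul (hF'.of_le (mod_cast le_top)))
  have hgood : ∀ᶠ t in 𝓝 (0 : Fin d → ℝ),
      (∀ x, |rsq x - rsq ((mat (F t)⁻¹).mulVec x)| ≤ rsq x / 4) ∧
      ∀ Z ∈ Submodule.span ℝ (lieAlg G),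
        fderiv ℝ (fun t => mat (F t)) t (R t Z) * mat (F t)⁻¹ = Z :=
    (eventually_abs_rsq_sub_le hF'.continuous hF0).and hFR
  obtain ⟨δ, hδ, hball⟩ := Metric.eventually_nhds_iff.1 hgood
  have hsmall : ∀ ε, 0 < ε → ε < δ → ∀ u ∈ tsupport ρ, dist (ε • u) 0 < δ := by
    intro ε hε hεδ u hu
    rw [hρs, mem_closedBall_zero_iff] at hu
    rw [dist_zero_right, norm_smul, Real.norm_of_nonneg hε.le]
    exact (mul_le_of_le_one_right hε.le hu).trans_lt hεδ
  have hmem : ∀ ε, 0 < ε → ε < δ → (wavg hGM volume ρ (fun u => F (ε • u)) φ,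
      fun i => wavg hGM volume (kernel ρ (v i) ε) (fun u => F (ε • u)) φ) ∈
      (polyGraph hM fun i => (X i : Matrix (Fin n) (Fin n) ℝ)).topologicalClosure :=
    fun ε hε hεδ => wavg_mem_polyGraph hM hGM hF hF' X hρ hρc hv hε.ne'
      (fun u hu => (hball (hsmall ε hε hεδ u hu)).1)
      (fun i u hu => (hball (hsmall ε hε hεδ u hu)).2 _ (Submodule.subset_span (X i).2)) φ
  -- the commutator of `dπ(X i)` with the mollification has the kernel of the field `v i - w i`
  have hcomm : ∀ i ε, 0 < ε → ε < δ →
      wavg hGM volume (kernel ρ (fun t => v i t - w i t) ε) (fun u => F (ε • u)) φ +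
        wavg hGM volume ρ (fun u => F (ε • u)) (ψ i) =
      wavg hGM volume (kernel ρ (v i) ε) (fun u => F (ε • u)) φ := by
    intro i ε hε hεδ
    rw [(hφ i).wavg_eq hM hGM hF hF' hρ hρc (hw i) hε.ne'
      (fun u hu => (hball (hsmall ε hε hεδ u hu)).2 _
        (conj_mem_span_lieAlg _ (Submodule.subset_span (X i).2))), wavg, wavg, wavg,
      ← integral_add
        (integrable_smul_leftRegular hM hGM hF hF' (continuous_kernel hρ ((hv i).sub (hw i)) ε)
          (hasCompactSupport_kernel hρc ε) ε φ)
        (integrable_smul_leftRegular hM hGM hF hF' (continuous_kernel hρ (hw i) ε)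
          (hasCompactSupport_kernel hρc ε) ε φ)]
    refine integral_congr_ae (Eventually.of_forall fun u => ?_)
    change kernel ρ (fun t => v i t - w i t) ε u • leftRegular hGM (F (ε • u)) φ +
      kernel ρ (w i) ε u • leftRegular hGM (F (ε • u)) φ =
      kernel ρ (v i) ε u • leftRegular hGM (F (ε • u)) φ
    rw [kernel_sub hρ (hv i) (hw i)]
    refine (add_smul _ _ (leftRegular hGM (F (ε • u)) φ)).symm.trans ?_
    rw [sub_add_cancel]
  have hρlim : ∀ χ : C₀(M, ℂ), Tendsto (fun ε => wavg hGM volume ρ (fun u => F (ε • u)) χ)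
      (𝓝[>] (0 : ℝ)) (𝓝 χ) := by
    intro χ
    obtain ⟨P, hP⟩ := hρ.continuous.bounded_above_of_compact_support hρc
    have := tendsto_wavg hM hGM hF hF' hF0 (k := fun _ => ρ) (C := P) (c := 1)
      (fun _ => hρ.continuous)
      (fun _ u hu => image_eq_zero_of_notMem_tsupport (by rwa [hρs])) (fun _ _ _ u => hP u)
      (fun _ _ => hρ1) χ
    rwa [one_smul] at this
  have hklim : ∀ i, Tendsto (fun ε => wavg hGM volume (kernel ρ (fun t => v i t - w i t) ε)
      (fun u => F (ε • u)) φ) (𝓝[>] (0 : ℝ)) (𝓝 0) := by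
    intro i
    -- `v i` and `w i` agree at `0` because `F 0 = 1`
    obtain ⟨C, hC⟩ := exists_abs_kernel_le hρ hρs.le ((hv i).sub (hw i)) (by
      simp only [v, w, hF0, inv_one, mat_one, one_mul, mul_one, sub_self])
    have := tendsto_wavg hM hGM hF hF' hF0 (k := fun ε => kernel ρ (fun t => v i t - w i t) ε)
      (C := C) (c := 0)
      (fun ε => continuous_kernel hρ ((hv i).sub (hw i)) ε)
      (fun ε u hu => kernel_eq_zero (by rwa [hρs])) hC
      (fun ε hε => integral_kernel hρ hρc ((hv i).sub (hw i)) hε.ne') φ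
    rwa [zero_smul] at this
  have hlim : Tendsto (fun ε => (wavg hGM volume ρ (fun u => F (ε • u)) φ,
      fun i => wavg hGM volume (kernel ρ (v i) ε) (fun u => F (ε • u)) φ))
      (𝓝[>] (0 : ℝ)) (𝓝 (φ, ψ)) := by
    refine (hρlim φ).prodMk_nhds (tendsto_pi_nhds.2 fun i => ?_)
    have h1 := (hklim i).add (hρlim (ψ i))
    rw [zero_add] at h1
    refine h1.congr' ?_
    filter_upwards [Ioo_mem_nhdsGT hδ] with ε hε
    exact hcomm i ε hε.1 hε.2
  refine IsClosed.mem_of_tendsto (Submodule.isClosed_topologicalClosure _) hlim ?_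
  filter_upwards [Ioo_mem_nhdsGT hδ] with ε hε
  exact hmem ε hε.1 hε.2

/-! ### Joint graphs and cores -/

theorem isGen_iff_mem_graph {hGM : Preserves G M} {X : lieAlg G} {φ ψ : C₀(M, ℂ)} :
    IsGen hGM X φ ψ ↔ (φ, ψ) ∈ (generator hGM X).graph := by
  rw [LinearPMap.mem_graph_iff]
  constructor
  · intro h
    exact ⟨⟨φ, h.differentiableAt⟩, rfl, h.deriv⟩
  · rintro ⟨⟨χ, hχ⟩, rfl, rfl⟩
    exact DifferentiableAt.hasDerivAt hχ

theorem mem_jointGraph_iff {k : ℕ} {hGM : Preserves G M} {X : Fin k → lieAlg G}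
    {z : C₀(M, ℂ) × (Fin k → C₀(M, ℂ))} :
    z ∈ jointGraph (fun i => generator hGM (X i)) ↔ ∀ i, IsGen hGM (X i) z.1 (z.2 i) := by
  constructor
  · rintro ⟨h, hz⟩ i
    rw [hz i]
    exact DifferentiableAt.hasDerivAt (h i)
  · intro h
    exact ⟨fun i => (h i).differentiableAt, fun i => (h i).deriv.symm⟩

theorem jointGraphRestrict_eq {k : ℕ} (hM : IsClosed M) {hGM : Preserves G M}
    {X : Fin k → lieAlg G} :
    jointGraphRestrict (fun i => generator hGM (X i)) (gaussPoly M) =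
      (polyGraph hM fun i => (X i : Matrix (Fin n) (Fin n) ℝ) :
        Set (C₀(M, ℂ) × (Fin k → C₀(M, ℂ)))) := by
  ext z
  rw [SetLike.mem_coe, mem_polyGraph]
  constructor
  · rintro ⟨hz, hz1, -⟩
    rw [mem_jointGraph_iff] at hz
    obtain ⟨p, hp⟩ := (mem_gaussPoly_iff hM).1 hz1
    refine ⟨p, Prod.ext hp (funext fun i => ?_)⟩
    have h := hz i
    rw [hp] at h
    exact h.unique (isGen_gp hM hGM (X i) p)
  · rintro ⟨p, rfl⟩
    exact ⟨mem_jointGraph_iff.2 fun i => isGen_gp hM hGM (X i) p,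
      (mem_gaussPoly_iff hM).2 ⟨p, rfl⟩, fun i => (mem_gaussPoly_iff hM).2 ⟨_, rfl⟩⟩

theorem jointGraph_eq_closure {k : ℕ} (hM : IsClosed M) (hGM : Preserves G M)
    (X : Fin k → lieAlg G) :
    jointGraph (fun i => generator hGM (X i)) =
      closure (jointGraphRestrict (fun i => generator hGM (X i)) (gaussPoly M)) := by
  refine Set.Subset.antisymm ?_ ?_
  · intro z hz
    rw [jointGraphRestrict_eq hM]
    exact mem_closure_polyGraph_of_isGen hM (mem_jointGraph_iff.1 hz)
  · refine closure_minimal (fun z hz => hz.1) ?_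
    have h : jointGraph (fun i => generator hGM (X i)) =
        ⋂ i, {z : C₀(M, ℂ) × (Fin k → C₀(M, ℂ)) | IsGen hGM (X i) z.1 (z.2 i)} := by
      ext z
      simp [mem_jointGraph_iff]
    rw [h]
    refine isClosed_iInter fun i => ?_
    have hc : Continuous fun z : C₀(M, ℂ) × (Fin k → C₀(M, ℂ)) => (z.1, z.2 i) :=
      continuous_fst.prodMk ((continuous_apply i).comp continuous_snd)
    exact (isClosed_isGen hGM (X i)).preimage hc

theorem hasCore_generator (hM : IsClosed M) (hGM : Preserves G M) (X : lieAlg G) :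
    (generator hGM X).HasCore (gaussPoly M) := by
  have hgen : ∀ p, (gp hM p, gp hM (gaussDer X p)) ∈ (generator hGM X).graph := fun p =>
    isGen_iff_mem_graph.1 (isGen_gp hM hGM X p)
  have hdom : gaussPoly M ≤ (generator hGM X).domain := fun φ hφ => by
    obtain ⟨p, rfl⟩ := (mem_gaussPoly_iff hM).1 hφ
    exact (isGen_gp hM hGM X p).differentiableAt
  have hclosed : (generator hGM X).IsClosed := by
    have h := isClosed_isGen hGM X
    simp only [isGen_iff_mem_graph] at h
    exact h
  have hle : (generator hGM X).domRestrict (gaussPoly M) ≤ generator hGM X :=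
    LinearPMap.domRestrict_le
  refine ⟨hdom, LinearPMap.eq_of_eq_graph ?_⟩
  rw [← (hclosed.isClosable.leIsClosable hle).graph_closure_eq_closure_graph]
  refine le_antisymm ?_ fun z hz => ?_
  · exact Submodule.topologicalClosure_minimal _ (LinearPMap.le_graph_of_le hle) hclosed
  · have h1 := (isGen_iff_mem_graph.2 hz).mem_closure_polyGraph hM
    have h2 : Set.MapsTo (fun y : C₀(M, ℂ) × (Unit → C₀(M, ℂ)) => (y.1, y.2 ()))
        (polyGraph hM fun _ : Unit => (X : Matrix (Fin n) (Fin n) ℝ))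
        ((generator hGM X).domRestrict (gaussPoly M)).graph := by
      intro y hy
      obtain ⟨p, rfl⟩ := (mem_polyGraph hM _ _).1 hy
      have hp : gp hM p ∈ gaussPoly M := (mem_gaussPoly_iff hM).2 ⟨p, rfl⟩
      refine (LinearPMap.mem_graph_iff _).2 ⟨⟨gp hM p, hp, hdom hp⟩, rfl, ?_⟩
      exact (isGen_gp hM hGM X p).deriv
    exact h2.closure (continuous_fst.prodMk ((continuous_apply ()).comp continuous_snd)) h1

theorem IsRealAffineVariety.isClosed (hM : IsRealAffineVariety M) : IsClosed M := by
  obtain ⟨S, rfl⟩ := hM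
  have h : {x | ∀ p ∈ S, MvPolynomial.eval x p = 0} =
      ⋂ p ∈ S, {x : Fin n → ℝ | MvPolynomial.eval x p = 0} := by
    ext x; simp
  rw [h]
  exact isClosed_biInter fun p _ =>
    isClosed_eq (MvPolynomial.continuous_eval p) continuous_const

end RealGVariety

end

theorem mainTheorem1 {n : ℕ} (G : Subgroup (GL (Fin n) ℝ))
    (hG : RealGVariety.IsRealLinearAlgebraicGroup G)
    (M : Set (Fin n → ℝ)) (hM : RealGVariety.IsRealAffineVariety M)
    (hM_smooth : RealGVariety.IsSmooth M) (hGM : RealGVariety.Preserves G M) :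
    (∀ (k : ℕ) (X : Fin k → RealGVariety.lieAlg G),
      RealGVariety.jointGraph (fun i => RealGVariety.generator hGM (X i)) =
        closure (RealGVariety.jointGraphRestrict
          (fun i => RealGVariety.generator hGM (X i)) (RealGVariety.gaussPoly M))) ∧
    (∀ (d : ℕ) (a : Fin d → RealGVariety.lieAlg G),
      LinearIndependent ℝ (fun i => (a i : Matrix (Fin n) (Fin n) ℝ)) →
      (Submodule.span ℝ (Set.range fun i => (a i : Matrix (Fin n) (Fin n) ℝ)) :
        Set (Matrix (Fin n) (Fin n) ℝ)) = RealGVariety.lieAlg G →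
      RealGVariety.jointGraph (fun i => RealGVariety.generator hGM (a i)) =
        closure (RealGVariety.jointGraphRestrict
          (fun i => RealGVariety.generator hGM (a i)) (RealGVariety.gaussPoly M))) ∧
    (∀ X : RealGVariety.lieAlg G,
      (RealGVariety.generator hGM X).HasCore (RealGVariety.gaussPoly M)) := by
  exact ⟨fun _ X => RealGVariety.jointGraph_eq_closure hM.isClosed hGM X,
    fun _ a _ _ => RealGVariety.jointGraph_eq_closure hM.isClosed hGM a,
    fun X => RealGVariety.hasCore_generator hM.isClosed hGM X⟩
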